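/- **Setting.** Let $\mathbb D$ be the unit disk with the hyperbolic metric $\frac{2|dz|}{1-|z|^2}$, and let $\Delta_0$ be the ideal triangle with vertices $1,i,-1\in S^1$. Let $\mathcal F$ be the Farey tesselation, i.e. the triangulation of $\mathbb D$ by ideal triangles obtained from $\Delta_0$ by repeated hyperbolic reflections in sides; $\mathcal F$ is identified with its set of edges. Let $s:\mathcal F\to\mathbb R$ be an arbitrary function. *Developing map.* For a complementary triangle $\Delta$ of $\mathcal F$, let $f_1,\dots,f_k$ be the edges crossed, in this order, by a geodesic arc from $\Delta_0$ to $\Delta$, each oriented so that $\Delta_0$ is on its left. Let $T_{f}^{t}$ be the hyperbolic translation with axis $f$ and translation length $|t|$ for which the initial point of $f$ is repelling if $t>0$ and attracting if $t<0$ (and $T_f^0=\mathrm{id}$). Put $h_s|_\Delta=T_{f_1}^{s(f_1)}\circ\cdots\circ T_{f_k}^{s(f_k)}$ (the identity if $\Delta=\Delta_0$). For an ideal vertex $x$ of $\mathcal F$, $h_s(x)\in S^1$ is the image of $x$ under $h_s|_\Delta$ for any complementary triangle $\Delta$ with vertex $x$; it does not depend on $\Delta$. *Condition.* For each vertex $p$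 of $\mathcal F$, index the edges of $\mathcal F$ with endpoint $p$ as $\{f_k^p\}_{k\in\mathbb Z}$ in the order in which they meet a horocycle based at $p$, oriented as the boundary of its horoball. Fix a horocycle $C_p$ based at $h_s(p)$, and let $\delta_k^p$ be the hyperbolic length of the arc of $C_p$ between the geodesics $h_s(f_k^p)$ and $h_s(f_{k+1}^p)$ (the geodesics joining the images of the endpoints). **Lemma.** Suppose that there is $M\ge 1$ such that for every vertex $p$ of $\mathcal F$, all $m\in\mathbb Z$ and all integers $k\ge 0$, $$\frac1M\le\frac{\delta_m^p+\delta_{m+1}^p+\cdots+\delta_{m+k}^p}{\delta_{m-1}^p+\delta_{m-2}^p+\cdots+\delta_{m-k-1}^p}\le M .$$ Then $h_s$ extends from the set of vertices of $\mathcal F$ to a homeomorphism $S^1\to S^1$. -/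

import Mathlib

open scoped ComplexConjugate

namespace Farey

/-! ### Hyperbolic reflections and translations, acting on the unit circle -/

/-- Reflection of the hyperbolic disk in the geodesic with ideal endpoints `a ≠ b`, i.e. the
anti-Möbius involution of the disk that fixes `a` and `b`, as a formula on the closed disk. -/
noncomputable def reflectionFormula (a b z : ℂ) : ℂ :=
  (2 * a * b * conj z - (a + b)) / ((a + b) * conj z - 2)

/-- The Möbius map `T` with `(T z - a) / (T z - b) = exp t * ((z - a) / (z - b))`: the hyperbolic
translation along the geodesic from `a` to `b`, of translation length `|t|`; the point `a` is
repelling (and `b` attracting) if `t > 0`, and conversely if `t < 0`. -/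
noncomputable def translationFormula (a b : ℂ) (t : ℝ) (z : ℂ) : ℂ :=
  (a * (z - b) - (Real.exp t : ℂ) * b * (z - a)) / ((z - b) - (Real.exp t : ℂ) * (z - a))

/-- Two points of the circle whose real inner product is one are equal. -/
theorem circle_eq_of_re (a b : Circle) (h : ((a : ℂ) * conj (b : ℂ)).re = 1) : a = b := by
  have ha : (a : ℂ).re * (a : ℂ).re + (a : ℂ).im * (a : ℂ).im = 1 := by
    simpa [Complex.normSq_apply] using Circle.normSq_coe a
  have hb : (b : ℂ).re * (b : ℂ).re + (b : ℂ).im * (b : ℂ).im = 1 := by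
    simpa [Complex.normSq_apply] using Circle.normSq_coe b
  simp only [Complex.mul_re, Complex.conj_re, Complex.conj_im] at h
  have h0 : ((a : ℂ).re - (b : ℂ).re) ^ 2 + ((a : ℂ).im - (b : ℂ).im) ^ 2 = 0 := by nlinarith
  have h1 : (a : ℂ).re - (b : ℂ).re = 0 := by
    have := sq_nonneg ((a : ℂ).im - (b : ℂ).im)
    exact pow_eq_zero_iff two_ne_zero |>.1 (le_antisymm (by linarith) (sq_nonneg _))
  have h2 : (a : ℂ).im - (b : ℂ).im = 0 := by
    have := sq_nonneg ((a : ℂ).re - (b : ℂ).re)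
    exact pow_eq_zero_iff two_ne_zero |>.1 (le_antisymm (by linarith) (sq_nonneg _))
  exact Circle.ext (Complex.ext (by linarith) (by linarith))

theorem norm_reflectionFormula {a b : Circle} (h : a ≠ b) (z : Circle) :
    ‖reflectionFormula a b z‖ = 1 := by
  have hab : ((a : ℂ) * conj (b : ℂ)).re ≠ 1 := fun h' => h (circle_eq_of_re a b h')
  have ha := Circle.normSq_coe a
  have hb := Circle.normSq_coe b
  have hz := Circle.normSq_coe z
  have key : Complex.normSq (2 * a * b * conj (z : ℂ) - (a + b)) =
      Complex.normSq (((a : ℂ) + b) * conj (z : ℂ) - 2) := by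
    have e : 2 * (a : ℂ) * b * conj (z : ℂ) - (a + b) =
        -(a * b * conj (z : ℂ)) * conj (((a : ℂ) + b) * conj (z : ℂ) - 2) := by
      simp only [← Circle.coe_inv_eq_conj, map_sub, map_mul, map_add, Circle.coe_inv, map_inv₀]
      simp only [inv_inv]
      rw [show (starRingEnd ℂ) 2 = 2 from Complex.conj_ofNat 2]
      field_simp [Circle.coe_ne_zero]
      ring
    rw [e, map_mul, Complex.normSq_conj, Complex.normSq_neg, map_mul, map_mul, Complex.normSq_conj,
      ha, hb, hz]; ring
  have hne : ((a : ℂ) + b) * conj (z : ℂ) - 2 ≠ 0 := by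
    intro h0
    have h1 : Complex.normSq (((a : ℂ) + b) * conj (z : ℂ)) = 4 := by
      rw [sub_eq_zero.1 h0]; norm_num [Complex.normSq_apply]
    rw [map_mul, Complex.normSq_conj, hz, mul_one, Complex.normSq_add, ha, hb] at h1
    exact hab (by linarith)
  rw [reflectionFormula, norm_div, Complex.norm_def, Complex.norm_def, key, div_self]
  exact Real.sqrt_ne_zero'.2 (Complex.normSq_pos.2 hne)

theorem norm_translationFormula {a b : Circle} (h : a ≠ b) (t : ℝ) (z : Circle) :
    ‖translationFormula a b t z‖ = 1 := by
  have hab : ((b : ℂ) * conj (a : ℂ)).re ≠ 1 := fun h' => h (circle_eq_of_re b a h').symm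
  have ha := Circle.normSq_coe a
  have hb := Circle.normSq_coe b
  have hz := Circle.normSq_coe z
  have ht : 0 < Real.exp t := Real.exp_pos t
  rw [translationFormula]
  generalize Real.exp t = r at ht ⊢
  have key : Complex.normSq ((a : ℂ) * (z - b) - r * b * (z - a)) =
      Complex.normSq (((z : ℂ) - b) - r * (z - a)) := by
    have e : (a : ℂ) * (z - b) - r * b * (z - a) =
        -(a * b * z) * conj (((z : ℂ) - b) - r * (z - a)) := by
      simp only [map_sub, map_mul, Complex.conj_ofReal]
      simp only [← Circle.coe_inv_eq_conj, Circle.coe_inv]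
      field_simp [Circle.coe_ne_zero]
      ring
    rw [e, map_mul, Complex.normSq_conj, Complex.normSq_neg, map_mul, map_mul, ha, hb, hz]; ring
  have hne : ((z : ℂ) - b) - r * (z - a) ≠ 0 := by
    intro h0
    have h2 : (z : ℂ) * ((1 - r : ℝ) : ℂ) = b - r * a := by
      push_cast; linear_combination h0
    have h1 := congrArg Complex.normSq h2
    rw [map_mul, Complex.normSq_ofReal, hz, Complex.normSq_sub, map_mul, Complex.normSq_ofReal,
      ha, hb, map_mul, Complex.conj_ofReal] at h1
    have h5 : ((b : ℂ) * ((r : ℂ) * conj (a : ℂ))).re = r * ((b : ℂ) * conj (a : ℂ)).re := by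
      simp; ring
    rw [h5] at h1
    have h3 : r * (((b : ℂ) * conj (a : ℂ)).re - 1) = 0 := by linarith
    rcases mul_eq_zero.1 h3 with h4 | h4
    · exact ht.ne' h4
    · exact hab (by linarith)
  rw [norm_div, Complex.norm_def, Complex.norm_def, key, div_self]
  exact Real.sqrt_ne_zero'.2 (Complex.normSq_pos.2 hne)

open Classical in
/-- Reflection in the geodesic with ideal endpoints `a ≠ b`, on the circle (the degenerate case
`a = b` never occurs below). -/
noncomputable def reflection (a b z : Circle) : Circle :=
  if h : a = b then z
  else ⟨reflectionFormula a b z, mem_sphere_zero_iff_norm.2 (norm_reflectionFormula h z)⟩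

open Classical in
/-- Signed hyperbolic translation by `t` along the geodesic from `a` to `b ≠ a`, on the circle (the
degenerate case `a = b` never occurs below). -/
noncomputable def translation (a b : Circle) (t : ℝ) (z : Circle) : Circle :=
  if h : a = b then z
  else ⟨translationFormula a b t z, mem_sphere_zero_iff_norm.2 (norm_translationFormula h t z)⟩

/-! ### The Farey tesselation -/

/-- The point `i` of the unit circle. -/
def ptI : Circle := ⟨Complex.I, mem_sphere_zero_iff_norm.2 Complex.norm_I⟩

/-- An oriented edge from `src` to `tgt` of an ideal triangulation of the disk, together with the
third vertex `apex` of the complementary triangle on its left. -/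
structure OrientedEdge where
  src : Circle
  tgt : Circle
  apex : Circle

/-- The ideal vertices of the complementary triangle to the left of an oriented edge. -/
def OrientedEdge.leftTriangle (e : OrientedEdge) : Set Circle := {e.src, e.tgt, e.apex}

/-- The three sides of the base triangle `Δ₀` with vertices `1, i, -1`, with `Δ₀` on the left. -/
noncomputable def baseSide : Fin 3 → OrientedEdge :=
  ![⟨1, ptI, -1⟩, ⟨ptI, -1, 1⟩, ⟨-1, 1, ptI⟩]

/-- The triangle on the right of `e` is the reflection in `e` of the triangle on the left of `e`. Its
two sides other than `e`, oriented so that it lies on their left. -/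
noncomputable def OrientedEdge.child (e : OrientedEdge) (t : Bool) : OrientedEdge :=
  let d := reflection e.src e.tgt e.apex
  if t then ⟨d, e.tgt, e.src⟩ else ⟨e.src, d, e.tgt⟩

/-- The edges of the Farey tesselation, oriented so that `Δ₀` is on the left. Each of them is reached
from exactly one side of `Δ₀` (the index in `Fin 3`) by successively reflecting the last
triangle in one of the two sides through which it was not entered. The list records the choices, the
latest first. The edges crossed by a geodesic arc from `Δ₀` to the triangle on the left of
`edge i l` are the `edge i l'` for the proper suffixes `l'` of `l`, crossed in the order of
increasing length. -/
noncomputable def edge (i : Fin 3) : List Bool → OrientedEdge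
  | [] => baseSide i
  | t :: l => (edge i l).child t

/-- The Farey tesselation as the set of its edges, each being the pair of its ideal endpoints. -/
def edges : Set (Sym2 Circle) :=
  {f | ∃ (i : Fin 3) (l : List Bool), f = s((edge i l).src, (edge i l).tgt)}

/-- The set of ideal endpoints of the edges of the Farey tesselation. -/
def vertices : Set Circle := {p | ∃ q, s(p, q) ∈ edges}

theorem edge_mem (i : Fin 3) (l : List Bool) :
    s((edge i l).src, (edge i l).tgt) ∈ edges := ⟨i, l, rfl⟩

/-! ### The developing map of a shear function -/

/-- The action on the circle of the Möbius map `h_σ|Δ = T₁ ∘ T₂ ∘ ⋯ ∘ Tₖ` which is the developing map of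
the shear function `σ` on the triangle `Δ` to the left of `edge i l`. Here `Tⱼ` is the translation
by `σ(fⱼ)` along `fⱼ`, where `f₁, …, fₖ` are the edges crossed on the way from `Δ₀` to `Δ`, in
this order, each oriented so that `Δ₀` is on its left. -/
noncomputable def developOn (σ : edges → ℝ) (i : Fin 3) : List Bool → Circle → Circle
  | [] => id
  | _ :: l => developOn σ i l ∘
      translation (edge i l).src (edge i l).tgt (σ ⟨_, edge_mem i l⟩)

/-- The point `y` is the image of `x` under the developing map on some complementary triangle of which
`x` is an ideal vertex. -/
def DevelopsTo (σ : edges → ℝ) (x y : Circle) : Prop :=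
  ∃ (i : Fin 3) (l : List Bool), x ∈ (edge i l).leftTriangle ∧ developOn σ i l x = y

open Classical in
/-- The developing map `h_σ` on the vertices of the Farey tesselation: the value at a vertex `x` is the
image of `x` under the developing map on any complementary triangle with vertex `x`. (The value
outside the set of vertices is irrelevant.) -/
noncomputable def developingMap (σ : edges → ℝ) (x : Circle) : Circle :=
  if h : ∃ y, DevelopsTo σ x y then h.choose else x

/-! ### Fans and lengths of horocyclic arcs -/

/-- The horocycle based at `p`, as the image of the horizontal line of height `η` under the Möbius map
`w ↦ p * (w - i) / (w + i)` from the upper half-plane to the disk, which sends `∞` to `p`.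
The orientation is that of the boundary of the horoball. -/
noncomputable def horocycle (p : Circle) (η : ℝ) (t : ℝ) : ℂ :=
  p * (((t : ℂ) + η * Complex.I - Complex.I) / ((t : ℂ) + η * Complex.I + Complex.I))

/-- The parameter at which the horocycles based at `p` cross the geodesic from `p` to `q ≠ p`: the real
number sent to `q` by the Möbius map `w ↦ p * (w - i) / (w + i)`. -/
noncomputable def horoParam (p q : Circle) : ℝ :=
  (Complex.I * ((p : ℂ) + q) / ((p : ℂ) - q)).re

/-- The length, for the hyperbolic metric `2 |dz| / (1 - |z|²)` of the disk, of the arc of the horocycle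
of height `η` based at `p` between the geodesics from `p` to `q` and from `p` to `r`. -/
noncomputable def horoArcLength (p : Circle) (η : ℝ) (q r : Circle) : ℝ :=
  ∫ t in (min (horoParam p q) (horoParam p r))..(max (horoParam p q) (horoParam p r)),
    2 * ‖deriv (horocycle p η) t‖ / (1 - ‖horocycle p η t‖ ^ 2)

/-- The fan with tip `p` is the set of all edges with endpoint `p`. It is indexed by `ℤ` as
`fₖ = s(p, q k)`, in the order in which the edges meet a horocycle based at `p`. -/
def IsFanIndexing (p : Circle) (q : ℤ → Circle) : Prop :=
  Set.BijOn q Set.univ {x | s(p, x) ∈ edges} ∧ StrictMono fun k => horoParam p (q k)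

/-- The length `δₖ` of the arc between the images under the developing map of the edges `s(p, q k)` and
`s(p, q (k + 1))`, of the horocycle of height `η` based at the image of the tip `p`. -/
noncomputable def fanLength (σ : edges → ℝ) (p : Circle) (η : ℝ) (q : ℤ → Circle) (k : ℤ) : ℝ :=
  horoArcLength (developingMap σ p) η (developingMap σ (q k)) (developingMap σ (q (k + 1)))

/-- There is `M ≥ 1` such that, for each fan, indexed by `ℤ`, with a horocycle fixed at the image of its
tip, all ratios `(δₘ + ⋯ + δₘ₊ₖ) / (δₘ₋₁ + ⋯ + δₘ₋ₖ₋₁)` lie in `[1 / M, M]`. (The choices of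
the indexing and of the horocycle do not matter.) -/
def HorocycleCondition (σ : edges → ℝ) : Prop :=
  ∃ M : ℝ, 1 ≤ M ∧ ∀ p ∈ vertices, ∃ q : ℤ → Circle, IsFanIndexing p q ∧ ∃ η : ℝ, 0 < η ∧
    ∀ (m : ℤ) (k : ℕ),
      1 / M ≤ (∑ j ∈ Finset.range (k + 1), fanLength σ p η q (m + j)) /
          (∑ j ∈ Finset.range (k + 1), fanLength σ p η q (m - 1 - j)) ∧
      (∑ j ∈ Finset.range (k + 1), fanLength σ p η q (m + j)) /
          (∑ j ∈ Finset.range (k + 1), fanLength σ p η q (m - 1 - j)) ≤ M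

end Farey

/-! The map `ray` identifies the circle with the real projective line. The vertices of the
tesselation become lines through primitive integral vectors. If an edge has ends `u`, `v`, the third
vertices of the two adjacent triangles are `v - u` and `u + v`, and the translation along the edge
is `diag(1, exp t)` in the basis `u`, `v`. Hence beyond each side of the base triangle the
tesselation is a binary tree of cones, each cut along `u + v`. The developing map carries it to the
tree with the same combinatorics in which cones are cut along `u + τ • v`, where `τ` is the
exponential of the shear (`edge_eq`, `developOn_ray`).

In an affine coordinate both trees become binary subdivisions of `[0, 1]`. The order of the cutting
points depends only on their labels, so if both sets of cutting points are dense, an increasing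
homeomorphism matches them (`Subdivision.exists_orderIso`). The homeomorphisms of the three arcs fix
the ends of the arcs and glue (`exists_homeomorph_arcs`).

What remains is density. For the Farey tree it is elementary. For the image tree
(`isDense_imageSubdivision`), suppose a gap contains no cutting point and follow the nested
intervals around it. Seen from a point `p`, horocyclic length is, up to an affine change, the
coordinate `1 / (p - q)`. If one end of the intervals is eventually constant, the condition at that
vertex makes the horocyclic length gain a definite amount at each doubling of the number of edges,
hence diverge, while the gap bounds it. Otherwise the intervals turn infinitely often. At a
right-left turn the condition with `k = 0` bounds from below, in terms of the gap, the distance by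
which the left end has just moved, although the left ends converge. -/

namespace Farey

/-! ### Points of the circle as directions in the plane -/

/-- The point `w / conj w` of the circle, which depends only on the real line spanned by `w`. -/
noncomputable def ray (w : ℂ) : Circle :=
  if h : w = 0 then 1 else ⟨w / conj w, mem_sphere_zero_iff_norm.2 (by
    rw [norm_div, Complex.norm_conj, div_self (norm_ne_zero_iff.2 h)])⟩

/-- The determinant of two vectors of the plane. -/
def wedge (u v : ℂ) : ℝ := u.re * v.im - u.im * v.re

theorem coe_ray {w : ℂ} (h : w ≠ 0) : (ray w : ℂ) = w / conj w :=
  congrArg (fun z : Circle => (z : ℂ)) (dif_neg h)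

theorem coe_reflection {a b : Circle} (h : a ≠ b) (z : Circle) :
    (reflection a b z : ℂ) = reflectionFormula a b z :=
  congrArg (fun z : Circle => (z : ℂ)) (dif_neg h)

theorem coe_translation {a b : Circle} (h : a ≠ b) (t : ℝ) (z : Circle) :
    (translation a b t z : ℂ) = translationFormula a b t z :=
  congrArg (fun z : Circle => (z : ℂ)) (dif_neg h)

theorem conj_ne_zero {w : ℂ} (h : w ≠ 0) : conj w ≠ 0 := by simpa using h

theorem wedge_eq (u v : ℂ) : (2 * wedge u v * Complex.I : ℂ) = conj u * v - u * conj v := by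
  apply Complex.ext <;> simp [wedge]; ring

theorem ray_eq_iff {u v : ℂ} (hu : u ≠ 0) (hv : v ≠ 0) : ray u = ray v ↔ wedge u v = 0 := by
  have h := wedge_eq u v
  have hu' := conj_ne_zero hu
  have hv' := conj_ne_zero hv
  constructor
  · intro e
    have e' := congrArg (fun z : Circle => (z : ℂ)) e
    simp only [coe_ray hu, coe_ray hv] at e'
    rw [div_eq_div_iff hu' hv'] at e'
    have : (2 * wedge u v * Complex.I : ℂ) = 0 := by rw [h, e']; ring
    simpa [Complex.I_ne_zero] using this
  · intro e
    rw [e] at h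
    apply Circle.ext
    rw [coe_ray hu, coe_ray hv, div_eq_div_iff hu' hv']
    simp only [Complex.ofReal_zero, mul_zero, zero_mul] at h
    linear_combination h

theorem ray_real_mul {r : ℝ} (hr : r ≠ 0) (w : ℂ) : ray (r * w) = ray w := by
  by_cases hw : w = 0
  · simp [hw]
  · have hr' : (r : ℂ) ≠ 0 := by exact_mod_cast hr
    rw [ray_eq_iff (mul_ne_zero hr' hw) hw]
    simp [wedge]; ring

theorem ray_neg (w : ℂ) : ray (-w) = ray w := by
  simpa using ray_real_mul (r := -1) (by norm_num) w

theorem ne_zero_of_wedge {u v : ℂ} (h : wedge u v ≠ 0) : u ≠ 0 ∧ v ≠ 0 := by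
  constructor <;> (rintro rfl; exact h (by simp [wedge]))

theorem ray_ne {u v : ℂ} (h : wedge u v ≠ 0) : ray u ≠ ray v := fun e =>
  h ((ray_eq_iff (ne_zero_of_wedge h).1 (ne_zero_of_wedge h).2).1 e)

/-- The reflection fixes the lines of `u` and `v`, so it is `diag(-1, 1)` in this basis up to scale.
In the proof, numerator and denominator share the factor `conj u * v - u * conj v`, nonzero by
`wedge_eq`. -/
theorem reflection_ray {u v : ℂ} (h : wedge u v ≠ 0) :
    reflection (ray u) (ray v) (ray (v - u)) = ray (u + v) := by
  obtain ⟨hu, hv⟩ := ne_zero_of_wedge h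
  have hs : u + v ≠ 0 := by
    intro e; apply h; rw [eq_neg_of_add_eq_zero_right e]; simp [wedge]; ring
  have hd : v - u ≠ 0 := by
    intro e; apply h; rw [sub_eq_zero.1 e]; simp [wedge]; ring
  have hk : (conj u * v - u * conj v : ℂ) ≠ 0 := by
    rw [← wedge_eq]
    simpa [Complex.I_ne_zero] using h
  apply Circle.ext
  rw [coe_reflection (ray_ne h)]
  simp only [coe_ray hs, reflectionFormula, coe_ray hu, coe_ray hv, coe_ray hd]
  have hu' := conj_ne_zero hu
  have hv' := conj_ne_zero hv
  have hs' := conj_ne_zero hs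
  have hd' := conj_ne_zero hd
  simp only [map_div₀, map_sub, map_add, Complex.conj_conj] at *
  set a := conj u
  set b := conj v
  have e1 : (2 * (u / a) * (v / b) * ((b - a) / (v - u)) - (u / a + v / b)) =
      (a * v - u * b) * (-(u + v)) / (a * b * (v - u)) := by
    field_simp; ring
  have e2 : ((u / a + v / b) * ((b - a) / (v - u)) - 2) =
      (a * v - u * b) * (-(a + b)) / (a * b * (v - u)) := by
    field_simp; ring
  rw [e1, e2]
  field_simp

/-- The translation multiplies the projective coordinate `β / α`, which vanishes at the source and
is infinite at the target, by `exp t`. -/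
theorem translation_ray {u v : ℂ} (h : wedge u v ≠ 0) (t α β : ℝ) (hn : α ≠ 0 ∨ β ≠ 0) :
    translation (ray u) (ray v) t (ray (α * u + β * v)) =
      ray (α * u + (Real.exp t * β : ℝ) * v) := by
  obtain ⟨hu, hv⟩ := ne_zero_of_wedge h
  have hcomb : ∀ α β : ℝ, (α ≠ 0 ∨ β ≠ 0) → (α * u + β * v : ℂ) ≠ 0 := by
    intro α β hn e
    have e1 : α * wedge u v = wedge (α * u + β * v) v := by simp [wedge]; ring
    have e2 : β * wedge u v = wedge u (α * u + β * v) := by simp [wedge]; ring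
    rw [e] at e1 e2
    simp only [wedge, Complex.zero_re, Complex.zero_im] at e1 e2
    rcases hn with hn | hn
    · exact mul_ne_zero hn h (by rw [wedge, e1]; ring)
    · exact mul_ne_zero hn h (by rw [wedge, e2]; ring)
  have ht : Real.exp t ≠ 0 := (Real.exp_pos t).ne'
  have hw := hcomb α β hn
  have hw2 := hcomb α (Real.exp t * β) (hn.imp_right (mul_ne_zero ht))
  have hk : (conj u * v - u * conj v : ℂ) ≠ 0 := by
    rw [← wedge_eq]
    simpa [Complex.I_ne_zero] using h
  apply Circle.ext
  rw [coe_translation (ray_ne h)]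
  simp only [coe_ray hw2, translationFormula, coe_ray hu, coe_ray hv, coe_ray hw]
  have hu' := conj_ne_zero hu
  have hv' := conj_ne_zero hv
  have hw' := conj_ne_zero hw
  have hw2' := conj_ne_zero hw2
  generalize Real.exp t = r at *
  simp only [map_mul, map_add, Complex.conj_ofReal, Complex.ofReal_mul] at *
  set a := conj u
  set b := conj v
  obtain ⟨D, hD⟩ : ∃ D, D = α * a + β * b := ⟨_, rfl⟩
  obtain ⟨D', hD'⟩ : ∃ D', D' = α * a + r * β * b := ⟨_, rfl⟩
  rw [← hD] at hw' ⊢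
  rw [← hD'] at hw2' ⊢
  have e1 : (u / a * ((α * u + β * v) / D - v / b) -
      r * (v / b) * ((α * u + β * v) / D - u / a)) =
      (a * v - u * b) * (-(α * u + r * β * v)) / (a * b * D) := by
    field_simp
    rw [hD]
    ring
  have e2 : ((α * u + β * v) / D - v / b) - r * ((α * u + β * v) / D - u / a) =
      (a * v - u * b) * (-D') / (a * b * D) := by
    field_simp
    rw [hD, hD']
    ring
  rw [e1, e2]
  field_simp

theorem horoParam_ray {u v : ℂ} (h : wedge u v ≠ 0) :
    horoParam (ray u) (ray v) = -((u.re * v.re + u.im * v.im) / wedge u v) := by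
  obtain ⟨hu, hv⟩ := ne_zero_of_wedge h
  have hu' := conj_ne_zero hu
  have hv' := conj_ne_zero hv
  have hw : (wedge u v : ℂ) ≠ 0 := by exact_mod_cast h
  have hd : u / conj u - v / conj v ≠ 0 := by
    rw [div_sub_div _ _ hu' hv']
    refine div_ne_zero ?_ (mul_ne_zero hu' hv')
    have : u * conj v - conj u * v = -(2 * wedge u v * Complex.I) := by rw [wedge_eq]; ring
    rw [this]
    simpa [Complex.I_ne_zero] using h
  have key : Complex.I * (u / conj u + v / conj v) / (u / conj u - v / conj v) =
      ((-((u.re * v.re + u.im * v.im) / wedge u v) : ℝ) : ℂ) := by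
    have hdot : (2 * ((u.re * v.re + u.im * v.im : ℝ) : ℂ)) = conj u * v + u * conj v := by
      apply Complex.ext <;> simp <;> ring
    have hwd := wedge_eq u v
    have e1 : u / conj u + v / conj v =
        2 * ((u.re * v.re + u.im * v.im : ℝ) : ℂ) / (conj u * conj v) := by
      rw [hdot]; field_simp; ring
    have e2 : u / conj u - v / conj v =
        -(2 * wedge u v * Complex.I) / (conj u * conj v) := by
      rw [hwd]; field_simp; ring
    rw [e1, e2, Complex.ofReal_neg, Complex.ofReal_div]
    field_simp
  rw [horoParam, coe_ray hu, coe_ray hv, key, Complex.ofReal_re]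

/-- The parametrization comes from a Cayley transform, an isometry from the upper half-plane with
metric `|dw| / Im w`; on the line of height `η` the density is the constant `1 / η`. -/
theorem horoArcLength_eq (p : Circle) {η : ℝ} (hη : 0 < η) (q r : Circle) :
    horoArcLength p η q r = |horoParam p r - horoParam p q| / η := by
  have hint : ∀ t : ℝ, 2 * ‖deriv (horocycle p η) t‖ / (1 - ‖horocycle p η t‖ ^ 2) = 1 / η := by
    intro t
    set w : ℂ := (t : ℂ) + η * Complex.I with hw
    have hne : w + Complex.I ≠ 0 := by
      intro e
      have := congrArg Complex.im e
      simp [hw] at this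
      linarith
    have hder : HasDerivAt (horocycle p η)
        (p * ((1 * (w + Complex.I) - (w - Complex.I) * 1) / (w + Complex.I) ^ 2)) t := by
      have h1 : HasDerivAt (fun t : ℝ => (t : ℂ) + η * Complex.I) 1 t :=
        (Complex.ofRealCLM.hasDerivAt (x := t)).add_const _
      exact ((h1.sub_const Complex.I).div (h1.add_const Complex.I) hne).const_mul (p : ℂ)
    have hN : 0 < ‖w + Complex.I‖ := norm_pos_iff.2 hne
    have n1 : ‖(p * ((1 * (w + Complex.I) - (w - Complex.I) * 1) / (w + Complex.I) ^ 2) : ℂ)‖ =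
        2 / ‖w + Complex.I‖ ^ 2 := by
      rw [norm_mul, Circle.norm_coe, one_mul, norm_div, norm_pow]
      congr 1
      rw [show (1 * (w + Complex.I) - (w - Complex.I) * 1) = 2 * Complex.I by ring]
      simp
    have n2 : ‖horocycle p η t‖ = ‖w - Complex.I‖ / ‖w + Complex.I‖ := by
      rw [horocycle, norm_mul, Circle.norm_coe, one_mul, norm_div]
    have n3 : ‖w + Complex.I‖ ^ 2 - ‖w - Complex.I‖ ^ 2 = 4 * η := by
      rw [Complex.sq_norm, Complex.sq_norm, Complex.normSq_apply, Complex.normSq_apply]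
      simp [hw]; ring
    rw [hder.deriv, n1, n2]
    have : 1 - (‖w - Complex.I‖ / ‖w + Complex.I‖) ^ 2 = 4 * η / ‖w + Complex.I‖ ^ 2 := by
      rw [← n3]; field_simp
    rw [this]
    field_simp
    norm_num
  rw [horoArcLength]
  simp only [hint, intervalIntegral.integral_const, smul_eq_mul, max_sub_min_eq_abs]
  ring

/-! ### Binary subdivisions of the unit interval -/

/-- A binary subdivision of `[0, 1]`: the interval `[lo l, hi l]` is cut at `mid l` into the
intervals of `false :: l` and `true :: l`. -/
structure Subdivision where
  lo : List Bool → ℝ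
  mid : List Bool → ℝ
  hi : List Bool → ℝ
  lo_nil : lo [] = 0
  hi_nil : hi [] = 1
  lo_true : ∀ l, lo (true :: l) = mid l
  hi_true : ∀ l, hi (true :: l) = hi l
  lo_false : ∀ l, lo (false :: l) = lo l
  hi_false : ∀ l, hi (false :: l) = mid l
  lo_lt_mid : ∀ l, lo l < mid l
  mid_lt_hi : ∀ l, mid l < hi l

namespace Subdivision

variable (S T : Subdivision)

theorem lo_le_cons (b : Bool) (l : List Bool) : S.lo l ≤ S.lo (b :: l) := by
  cases b
  · rw [S.lo_false]
  · rw [S.lo_true]; exact (S.lo_lt_mid l).le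

theorem hi_cons_le (b : Bool) (l : List Bool) : S.hi (b :: l) ≤ S.hi l := by
  cases b
  · rw [S.hi_false]; exact (S.mid_lt_hi l).le
  · rw [S.hi_true]

theorem lo_le_append (k l : List Bool) : S.lo l ≤ S.lo (k ++ l) := by
  induction k with
  | nil => exact le_rfl
  | cons b k ih => exact ih.trans (S.lo_le_cons b _)

theorem hi_append_le (k l : List Bool) : S.hi (k ++ l) ≤ S.hi l := by
  induction k with
  | nil => exact le_rfl
  | cons b k ih => exact (S.hi_cons_le b _).trans ih

theorem lo_nonneg (l : List Bool) : 0 ≤ S.lo l := by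
  simpa [S.lo_nil] using S.lo_le_append l []

theorem hi_le_one (l : List Bool) : S.hi l ≤ 1 := by
  simpa [S.hi_nil] using S.hi_append_le l []

theorem lo_lt_hi (l : List Bool) : S.lo l < S.hi l := (S.lo_lt_mid l).trans (S.mid_lt_hi l)

theorem mid_pos (l : List Bool) : 0 < S.mid l := (S.lo_nonneg l).trans_lt (S.lo_lt_mid l)

theorem mid_lt_one (l : List Bool) : S.mid l < 1 := (S.mid_lt_hi l).trans_le (S.hi_le_one l)

/-- Intervals of equal depth coincide or do not overlap. Which one lies to the left is decided by
the labels alone, hence the quantifier over subdivisions inside the alternatives. -/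
theorem hi_le_lo_or {l l' : List Bool} (h : l.length = l'.length) :
    l = l' ∨ (∀ S : Subdivision, S.hi l ≤ S.lo l') ∨ (∀ S : Subdivision, S.hi l' ≤ S.lo l) := by
  induction l generalizing l' with
  | nil => left; exact (List.length_eq_zero_iff.1 h.symm).symm
  | cons b l ih =>
    cases l' with
    | nil => simp at h
    | cons c k =>
      rcases ih (l' := k) (by simpa using h) with rfl | h' | h'
      · cases b <;> cases c
        · left; rfl
        · right; left; intro S; rw [S.hi_false, S.lo_true]
        · right; right; intro S; rw [S.hi_false, S.lo_true]
        · left; rfl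
      · right; left; intro S
        exact (S.hi_cons_le b l).trans ((h' S).trans (S.lo_le_cons c k))
      · right; right; intro S
        exact (S.hi_cons_le c k).trans ((h' S).trans (S.lo_le_cons b l))

theorem mid_lt_or_aux {l l' : List Bool} (h : l.length ≤ l'.length) :
    l = l' ∨ (∀ S : Subdivision, S.mid l < S.mid l') ∨
      (∀ S : Subdivision, S.mid l' < S.mid l) := by
  -- The latest choice comes first, so `r` labels the ancestor of `l'` at the depth of `l`. If `r =
  -- l`, the choice made just after `l` decides on which side of `mid l` the point lies.
  obtain ⟨k, r, rfl, hr⟩ : ∃ k r, l' = k ++ r ∧ l.length = r.length :=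
    ⟨l'.take (l'.length - l.length), l'.drop (l'.length - l.length),
      (List.take_append_drop _ _).symm, by rw [List.length_drop]; omega⟩
  rcases hi_le_lo_or hr with rfl | h' | h'
  · rcases k.eq_nil_or_concat with rfl | ⟨k, b, rfl⟩
    · left; rfl
    · rw [List.concat_eq_append, List.append_assoc, List.singleton_append]
      cases b
      · right; right; intro S
        calc _ < _ := S.mid_lt_hi _
          _ ≤ _ := S.hi_append_le k _
          _ = _ := S.hi_false l
      · right; left; intro S
        calc _ = _ := (S.lo_true l).symm
          _ ≤ _ := S.lo_le_append k _
          _ < _ := S.lo_lt_mid _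
  · right; left; intro S
    exact (S.mid_lt_hi l).trans_le
      ((h' S).trans ((S.lo_le_append k r).trans (S.lo_lt_mid _).le))
  · right; right; intro S
    exact (S.mid_lt_hi _).trans_le
      ((S.hi_append_le k r).trans ((h' S).trans (S.lo_lt_mid l).le))

theorem mid_lt_or (l l' : List Bool) :
    l = l' ∨ (∀ S : Subdivision, S.mid l < S.mid l') ∨
      (∀ S : Subdivision, S.mid l' < S.mid l) := by
  rcases le_total l.length l'.length with h | h
  · exact mid_lt_or_aux h
  · rcases mid_lt_or_aux h with h | h | h
    · exact Or.inl h.symm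
    · exact Or.inr (Or.inr h)
    · exact Or.inr (Or.inl h)

/-- The points of a subdivision: the two ends of the unit interval and the cutting points. -/
def pt : Bool ⊕ List Bool → ℝ
  | .inl false => 0
  | .inl true => 1
  | .inr l => S.mid l

theorem pt_mem (d : Bool ⊕ List Bool) : S.pt d ∈ Set.Icc (0 : ℝ) 1 := by
  rcases d with (_ | _) | l
  · simp [pt]
  · simp [pt]
  · exact ⟨(S.mid_pos l).le, (S.mid_lt_one l).le⟩

theorem pt_lt {d e : Bool ⊕ List Bool} (h : S.pt d < S.pt e) : T.pt d < T.pt e := by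
  rcases d with (_ | _) | l <;> rcases e with (_ | _) | l'
  · simp [pt] at h
  · simp [pt]
  · exact T.mid_pos l'
  · simp [pt] at h; linarith
  · simp [pt] at h
  · exact absurd h (S.mid_lt_one l').le.not_gt
  · exact absurd h (S.mid_pos l).le.not_gt
  · exact T.mid_lt_one l
  · rcases mid_lt_or l l' with rfl | h' | h'
    · exact absurd h (lt_irrefl _)
    · exact h' T
    · exact absurd h (h' S).le.not_gt

theorem pt_le_iff (d e : Bool ⊕ List Bool) : S.pt d ≤ S.pt e ↔ T.pt d ≤ T.pt e := by
  rw [← not_lt, ← not_lt]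
  exact not_congr ⟨S.pt_lt T, T.pt_lt S⟩

theorem pt_eq {d e : Bool ⊕ List Bool} (h : S.pt d = S.pt e) : T.pt d = T.pt e :=
  le_antisymm ((S.pt_le_iff T _ _).1 h.le) ((S.pt_le_iff T _ _).1 h.ge)

theorem exists_lo_eq_pt (l : List Bool) : ∃ d, ∀ S : Subdivision, S.lo l = S.pt d := by
  induction l with
  | nil => exact ⟨.inl false, fun S => S.lo_nil⟩
  | cons b l ih =>
    cases b
    · obtain ⟨d, hd⟩ := ih
      exact ⟨d, fun S => by rw [S.lo_false, hd]⟩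
    · exact ⟨.inr l, fun S => S.lo_true l⟩

theorem exists_hi_eq_pt (l : List Bool) : ∃ d, ∀ S : Subdivision, S.hi l = S.pt d := by
  induction l with
  | nil => exact ⟨.inl true, fun S => S.hi_nil⟩
  | cons b l ih =>
    cases b
    · exact ⟨.inr l, fun S => S.hi_false l⟩
    · obtain ⟨d, hd⟩ := ih
      exact ⟨d, fun S => by rw [S.hi_true, hd]⟩

/-- The cutting points of the subdivision are dense. -/
def IsDense : Prop := ∀ α β : ℝ, 0 ≤ α → α < β → β ≤ 1 → ∃ l, S.mid l ∈ Set.Ioo α β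

open Classical in
/-- The branch of the subdivision that follows the interval from `α` to the right. -/
noncomputable def branch (α : ℝ) : ℕ → List Bool
  | 0 => []
  | n + 1 => decide (S.mid (branch α n) ≤ α) :: branch α n

variable {S T}

/-- If no cutting point lies strictly between `α` and `β`, no cut separates them, so every interval
of the branch contains `[α, β]`. -/
theorem branch_spec {α β : ℝ} (h0 : 0 ≤ α) (h1 : β ≤ 1)
    (h : ∀ l, S.mid l ∉ Set.Ioo α β) (n : ℕ) :
    S.lo (S.branch α n) ≤ α ∧ β ≤ S.hi (S.branch α n) := by
  induction n with
  | zero => simpa [branch, S.lo_nil, S.hi_nil] using ⟨h0, h1⟩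
  | succ n ih =>
    rw [branch]
    by_cases hm : S.mid (S.branch α n) ≤ α
    · simp only [hm, decide_true, S.lo_true, S.hi_true]
      exact ⟨trivial, ih.2⟩
    · simp only [hm, decide_false, S.lo_false, S.hi_false]
      exact ⟨ih.1, not_lt.1 fun h' => h _ ⟨not_le.1 hm, h'⟩⟩

theorem branch_add_replicate {α : ℝ} {b : Bool} {N : ℕ}
    (h : ∀ n ≥ N, S.branch α (n + 1) = b :: S.branch α n) (k : ℕ) :
    S.branch α (N + k) = List.replicate k b ++ S.branch α N := by
  induction k with
  | zero => rfl
  | succ k ih => rw [← add_assoc, h _ (by omega), ih, List.replicate_succ, List.cons_append]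

/-- A sequence whose increments over `[N, 2N]` dominate those over `[0, N]` is unbounded. -/
theorem not_bounded_of_doubling {g : ℕ → ℝ} {M B : ℝ} (hM : 0 < M) (hg : g 0 < g 1)
    (h : ∀ N, 1 ≤ N → g N - g 0 ≤ M * (g (2 * N) - g N)) : ¬ ∀ n, g n ≤ B := by
  intro hB
  -- Each doubling of the index gains at least `c`, because `g (2 ^ k) - g 0` never falls below `g 1
  -- - g 0`.
  set c := (g 1 - g 0) / M with hc
  have hc0 : 0 < c := div_pos (by linarith) hM
  have key : ∀ k : ℕ, g 1 + k * c ≤ g (2 ^ k) := by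
    intro k
    induction k with
    | zero => simp
    | succ k ih =>
      have h1 := h (2 ^ k) Nat.one_le_two_pow
      have h2 : c * M ≤ M * (g (2 * 2 ^ k) - g (2 ^ k)) := by
        rw [hc, div_mul_cancel₀ _ hM.ne']
        have : (0 : ℝ) ≤ k * c := by positivity
        linarith
      have h3 : c ≤ g (2 * 2 ^ k) - g (2 ^ k) := by
        rw [mul_comm] at h2; exact le_of_mul_le_mul_left h2 hM
      rw [pow_succ, mul_comm (2 ^ k)]
      push_cast
      linarith
  obtain ⟨k, hk⟩ := exists_nat_gt ((B - g 1) / c)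
  rw [div_lt_iff₀ hc0] at hk
  linarith [key k, hB (2 ^ k)]

/-- Density of a subdivision from a comparison of neighbouring intervals at a turn, and from a
comparison of blocks of intervals that share an endpoint. -/
theorem isDense_of_comparison {M : ℝ} (hM : 0 < M)
    (turn : ∀ l, 1 / (S.mid l - S.lo l) + 1 / (S.hi l - S.mid l) ≤
      M * (1 / (S.mid (true :: l) - S.mid l) - 1 / (S.hi l - S.mid l)))
    (run_hi : ∀ l N, 1 ≤ N →
      1 / (S.hi l - S.lo (List.replicate N true ++ l)) - 1 / (S.hi l - S.lo l) ≤
      M * (1 / (S.hi l - S.lo (List.replicate (2 * N) true ++ l)) -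
        1 / (S.hi l - S.lo (List.replicate N true ++ l))))
    (run_lo : ∀ l N, 1 ≤ N →
      1 / (S.hi (List.replicate N false ++ l) - S.lo l) - 1 / (S.hi l - S.lo l) ≤
      M * (1 / (S.hi (List.replicate (2 * N) false ++ l) - S.lo l) -
        1 / (S.hi (List.replicate N false ++ l) - S.lo l))) :
    S.IsDense := by
  intro α β h0 hαβ h1
  by_contra! hno
  have hb := branch_spec h0 h1 hno
  have hpos : 0 < β - α := sub_pos.2 hαβ
  have hstep : ∀ n, S.branch α (n + 1) = true :: S.branch α n ∨
      S.branch α (n + 1) = false :: S.branch α n := by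
    intro n
    rw [branch]
    cases decide (S.mid (S.branch α n) ≤ α)
    · exact Or.inr rfl
    · exact Or.inl rfl
  -- Eventually only right turns: the right end is fixed, and the reciprocal lengths stay below `1 /
  -- (β - α)`, against the doubling estimate. The next case is its mirror image.
  by_cases hA : ∃ N, ∀ n ≥ N, S.branch α (n + 1) = true :: S.branch α n
  · obtain ⟨N, hN⟩ := hA
    have hr := branch_add_replicate hN
    set l := S.branch α N
    refine not_bounded_of_doubling (B := 1 / (β - α))
      (g := fun k => 1 / (S.hi l - S.lo (List.replicate k true ++ l))) hM ?_
      (run_hi l) ?_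
    · have a1 := S.lo_lt_mid l
      have a2 := S.mid_lt_hi l
      simp only [List.replicate_zero, List.nil_append, List.replicate_one, List.singleton_append,
        S.lo_true]
      exact one_div_lt_one_div_of_lt (by linarith) (by linarith)
    · intro k
      have := (hb (N + k)).1
      rw [hr] at this
      exact one_div_le_one_div_of_le hpos (by linarith [(hb N).2])
  by_cases hB : ∃ N, ∀ n ≥ N, S.branch α (n + 1) = false :: S.branch α n
  · obtain ⟨N, hN⟩ := hB
    have hr := branch_add_replicate hN
    set l := S.branch α N
    refine not_bounded_of_doubling (B := 1 / (β - α))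
      (g := fun k => 1 / (S.hi (List.replicate k false ++ l) - S.lo l)) hM ?_
      (run_lo l) ?_
    · have a1 := S.lo_lt_mid l
      have a2 := S.mid_lt_hi l
      simp only [List.replicate_zero, List.nil_append, List.replicate_one, List.singleton_append,
        S.hi_false]
      exact one_div_lt_one_div_of_lt (by linarith) (by linarith)
    · intro k
      have := (hb (N + k)).2
      rw [hr] at this
      exact one_div_le_one_div_of_le hpos (by linarith [(hb N).1])
  push Not at hA hB
  -- Otherwise a right step followed by a left step occurs arbitrarily late.
  have hturn : ∀ N, ∃ n ≥ N, S.branch α (n + 1) = true :: S.branch α n ∧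
      S.branch α (n + 2) = false :: S.branch α (n + 1) := by
    intro N
    obtain ⟨a, haN, ha⟩ := hB N
    have ha' := (hstep a).resolve_right ha
    by_contra! hcon
    have hall : ∀ n ≥ a, S.branch α (n + 1) = true :: S.branch α n := by
      intro n hn
      induction n, hn using Nat.le_induction with
      | base => exact ha'
      | succ n hn ih => exact (hstep (n + 1)).resolve_right (hcon n (haN.trans hn) ih)
    obtain ⟨c, hc, hc'⟩ := hA a
    exact hc' (hall c hc)
  have hmono : Monotone fun n => S.lo (S.branch α n) :=
    monotone_nat_of_le_succ fun n => by rw [branch]; exact S.lo_le_cons _ _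
  -- The left ends increase and are bounded by `α`, so their increments tend to zero; at a right
  -- step the increment is `mid l - lo l`.
  have hlim := tendsto_atTop_ciSup hmono ⟨α, by rintro _ ⟨n, rfl⟩; exact (hb n).1⟩
  have hdiff : Filter.Tendsto (fun n => S.lo (S.branch α (n + 1)) - S.lo (S.branch α n))
      Filter.atTop (nhds 0) := by
    simpa using (hlim.comp (Filter.tendsto_add_atTop_nat 1)).sub hlim
  obtain ⟨N, hN⟩ := Filter.eventually_atTop.1
    (hdiff.eventually (gt_mem_nhds (div_pos hpos hM)))
  obtain ⟨n, hn, e1, e2⟩ := hturn N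
  have hsmall := hN n hn
  have t := turn (S.branch α n)
  have b2 := (hb (n + 2)).2
  rw [e2, S.hi_false, e1] at b2
  have b1 := (hb (n + 1)).1
  rw [e1, S.lo_true] at b1
  rw [e1, S.lo_true] at hsmall
  set l := S.branch α n
  have p1 : 0 < S.mid l - S.lo l := sub_pos.2 (S.lo_lt_mid l)
  have p2 : 0 < 1 / (S.hi l - S.mid l) := one_div_pos.2 (sub_pos.2 (S.mid_lt_hi l))
  -- After the right-left turn the interval is `[mid l, mid (true :: l)]`, which contains `[α, β]`.
  have p3 : 1 / (S.mid (true :: l) - S.mid l) ≤ 1 / (β - α) :=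
    one_div_le_one_div_of_le hpos (by linarith)
  have p4 : 1 / (S.mid l - S.lo l) ≤ M * (1 / (β - α)) := by
    have : M * (1 / (S.mid (true :: l) - S.mid l) - 1 / (S.hi l - S.mid l)) ≤ M * (1 / (β - α)) :=
      mul_le_mul_of_nonneg_left (by linarith) hM.le
    linarith
  rw [mul_one_div, div_le_div_iff₀ p1 hpos] at p4
  rw [lt_div_iff₀ hM] at hsmall
  linarith

/-- Density of a subdivision whose intervals shrink uniformly with the depth. -/
theorem isDense_of_length_le
    (h : ∀ l, (S.hi l - S.lo l) * (l.length + 1) ≤ 1) : S.IsDense := by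
  intro α β h0 hαβ h1
  by_contra! hno
  have hb := branch_spec h0 h1 hno
  have hlen : ∀ n, (S.branch α n).length = n := by
    intro n
    induction n with
    | zero => rfl
    | succ n ih => rw [branch, List.length_cons, ih]
  obtain ⟨n, hn⟩ := exists_nat_gt (1 / (β - α))
  rw [div_lt_iff₀ (sub_pos.2 hαβ)] at hn
  have h2 := h (S.branch α n)
  rw [hlen] at h2
  have h3 : β - α ≤ S.hi (S.branch α n) - S.lo (S.branch α n) := by linarith [hb n]
  have h4 : (β - α) * (n + 1) ≤ 1 :=
    (mul_le_mul_of_nonneg_right h3 (by positivity)).trans h2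
  nlinarith

theorem IsDense.dense_pt (hS : S.IsDense) :
    ∀ a b : Set.Icc (0 : ℝ) 1, a < b →
      ∃ d, a < (⟨S.pt d, S.pt_mem d⟩ : Set.Icc (0 : ℝ) 1) ∧
        (⟨S.pt d, S.pt_mem d⟩ : Set.Icc (0 : ℝ) 1) < b := by
  intro a b hab
  obtain ⟨l, hl⟩ := hS a b a.2.1 hab b.2.2
  exact ⟨.inr l, hl.1, hl.2⟩

/-- Two dense subdivisions are related by an increasing homeomorphism of the unit interval. -/
theorem exists_orderIso (hS : S.IsDense) (hT : T.IsDense) :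
    ∃ F : Set.Icc (0 : ℝ) 1 ≃o Set.Icc (0 : ℝ) 1,
      ∀ d, F ⟨S.pt d, S.pt_mem d⟩ = ⟨T.pt d, T.pt_mem d⟩ := by
  let I := Set.Icc (0 : ℝ) 1
  let f : Bool ⊕ List Bool → I := fun d => ⟨S.pt d, S.pt_mem d⟩
  let g : Bool ⊕ List Bool → I := fun d => ⟨T.pt d, T.pt_mem d⟩
  have hfg : ∀ d e, f d ≤ f e ↔ g d ≤ g e := fun d e => S.pt_le_iff T d e
  -- Density of `S` makes this monotone extension strict. Density of `T` makes its range dense,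
  -- whence continuity, and surjectivity by compactness.
  let F : I → I := fun s => sSup (g '' {d | f d ≤ s})
  have hF : ∀ d, F (f d) = g d := fun d => le_antisymm
    (sSup_le (by rintro _ ⟨e, he, rfl⟩; exact (hfg e d).1 he))
    (le_sSup ⟨d, le_refl (f d), rfl⟩)
  have hmono : Monotone F := fun s s' h =>
    sSup_le_sSup (Set.image_mono fun d (hd : f d ≤ s) => hd.trans h)
  have hstrict : StrictMono F := by
    intro s s' h
    obtain ⟨d, hd1, hd2⟩ := hS.dense_pt s s' h
    obtain ⟨e, he1, he2⟩ := hS.dense_pt _ _ hd2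
    calc F s ≤ F (f d) := hmono hd1.le
      _ = g d := hF d
      _ < g e := lt_of_not_ge fun h' => he1.not_ge ((hfg e d).2 h')
      _ = F (f e) := (hF e).symm
      _ ≤ F s' := hmono he2.le
  have hdense : DenseRange F := by
    refine dense_of_exists_between fun a b hab => ?_
    obtain ⟨d, hd⟩ := hT.dense_pt a b hab
    exact ⟨g d, ⟨f d, hF d⟩, hd⟩
  have hcont : Continuous F := hmono.continuous_of_denseRange hdense
  have hsurj : Function.Surjective F := by
    rw [← Set.range_eq_univ, ← (isCompact_range hcont).isClosed.closure_eq]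
    exact hdense.closure_eq
  exact ⟨hstrict.orderIsoOfSurjective F hsurj, hF⟩

end Subdivision

/-! ### Linear coordinates on the three sides of the base triangle -/

/-- Vectors that represent the initial points of the sides of the base triangle. -/
def baseStart : Fin 3 → ℂ := ![⟨1, 0⟩, ⟨1, 1⟩, ⟨0, 1⟩]

/-- Vectors that represent the final points of the sides of the base triangle. -/
def baseEnd : Fin 3 → ℂ := ![⟨1, 1⟩, ⟨0, 1⟩, ⟨-1, 0⟩]

/-- The vector with given coordinates with respect to the basis belonging to a side. -/
noncomputable def vec (i : Fin 3) (w : ℝ × ℝ) : ℂ := w.1 * baseStart i + w.2 * baseEnd i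

/-- The determinant of two coordinate vectors. -/
def cross (w w' : ℝ × ℝ) : ℝ := w.1 * w'.2 - w.2 * w'.1

/-- The position in `[0, 1]` of the direction of a coordinate vector. -/
noncomputable def pos (w : ℝ × ℝ) : ℝ := w.2 / (w.1 + w.2)

/-- The arc of the circle beyond a side of the base triangle, parametrized by `[0, 1]`. -/
noncomputable def arcPoint (i : Fin 3) (s : ℝ) : Circle := ray (vec i (1 - s, s))

/-- Each of the three bases has determinant one. -/
theorem wedge_vec (i : Fin 3) (w w' : ℝ × ℝ) : wedge (vec i w) (vec i w') = cross w w' := by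
  fin_cases i <;> simp [wedge, vec, cross, baseStart, baseEnd] <;> ring

theorem vec_add (i : Fin 3) (w w' : ℝ × ℝ) : vec i (w + w') = vec i w + vec i w' := by
  simp [vec]; ring

theorem vec_smul (i : Fin 3) (r : ℝ) (w : ℝ × ℝ) : vec i (r • w) = r * vec i w := by
  simp [vec]; ring

theorem ray_vec (i : Fin 3) {w : ℝ × ℝ} (h : 0 < w.1 + w.2) :
    ray (vec i w) = arcPoint i (pos w) := by
  have : w = (w.1 + w.2) • ((1 - pos w, pos w) : ℝ × ℝ) := by
    ext
    · simp only [pos, Prod.smul_fst, smul_eq_mul]; field_simp; ring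
    · simp only [pos, Prod.smul_snd, smul_eq_mul]; field_simp
  rw [arcPoint]
  conv_lhs => rw [this]
  rw [vec_smul, ray_real_mul h.ne']

theorem pos_sub_pos {w w' : ℝ × ℝ} (h : 0 < w.1 + w.2) (h' : 0 < w'.1 + w'.2) :
    pos w' - pos w = cross w w' / ((w.1 + w.2) * (w'.1 + w'.2)) := by
  rw [pos, pos, cross]; field_simp; ring

theorem pos_smul {r : ℝ} (hr : r ≠ 0) (w : ℝ × ℝ) : pos (r • w) = pos w := by
  simp only [pos, Prod.smul_fst, Prod.smul_snd, smul_eq_mul]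
  rw [← mul_add, mul_div_mul_left _ _ hr]

theorem ray_one : ray ⟨1, 0⟩ = 1 := by
  apply Circle.ext
  rw [coe_ray (by simp [Complex.ext_iff])]
  rw [show (⟨1, 0⟩ : ℂ) = 1 from rfl]
  simp

theorem ray_diag : ray ⟨1, 1⟩ = ptI := by
  apply Circle.ext
  have h : (⟨1, 1⟩ : ℂ) ≠ 0 := by simp [Complex.ext_iff]
  rw [coe_ray h, div_eq_iff (conj_ne_zero h)]
  change _ = Complex.I * _
  simp [Complex.ext_iff]

theorem ray_I : ray ⟨0, 1⟩ = -1 := by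
  apply Circle.ext
  have h : (⟨0, 1⟩ : ℂ) ≠ 0 := by simp [Complex.ext_iff]
  rw [coe_ray h, div_eq_iff (conj_ne_zero h)]
  simp [Complex.ext_iff]

theorem baseSide_eq (i : Fin 3) :
    baseSide i = ⟨ray (baseStart i), ray (baseEnd i), ray (baseEnd i - baseStart i)⟩ := by
  have h1 : ray ⟨-1, 0⟩ = 1 := by
    rw [← ray_one, ← ray_neg ⟨1, 0⟩]; congr 1; simp [Complex.ext_iff]
  fin_cases i
  · have : (⟨1, 1⟩ - ⟨1, 0⟩ : ℂ) = ⟨0, 1⟩ := by simp [Complex.ext_iff]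
    simp [baseSide, baseStart, baseEnd, ray_one, ray_diag, this, ray_I]
  · have : (⟨0, 1⟩ - ⟨1, 1⟩ : ℂ) = ⟨-1, 0⟩ := by simp [Complex.ext_iff]
    simp [baseSide, baseStart, baseEnd, ray_diag, this, ray_I, h1]
  · have : (⟨-1, 0⟩ - ⟨0, 1⟩ : ℂ) = -⟨1, 1⟩ := by simp [Complex.ext_iff]
    simp [baseSide, baseStart, baseEnd, this, ray_neg, ray_diag, ray_I, h1]

/-! ### The tree of cones -/

/-- The cones spanned by two vectors, obtained from the quadrant by repeated cutting: the cone spanned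
by `u` and `v` is cut along `u + τ • v`. -/
def cone (τ : List Bool → ℝ) : List Bool → (ℝ × ℝ) × (ℝ × ℝ)
  | [] => ((1, 0), (0, 1))
  | true :: l => ((cone τ l).1 + τ l • (cone τ l).2, τ l • (cone τ l).2)
  | false :: l => ((cone τ l).1, (cone τ l).1 + τ l • (cone τ l).2)

/-- A pair of vectors of the closed quadrant that is positively oriented. -/
structure IsPositivePair (C : (ℝ × ℝ) × (ℝ × ℝ)) : Prop where
  fst_fst : 0 ≤ C.1.1
  fst_snd : 0 ≤ C.1.2
  snd_fst : 0 ≤ C.2.1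
  snd_snd : 0 ≤ C.2.2
  cross_pos : 0 < cross C.1 C.2

theorem IsPositivePair.weight_fst {C : (ℝ × ℝ) × (ℝ × ℝ)} (h : IsPositivePair C) :
    0 < C.1.1 + C.1.2 := by
  obtain ⟨h1, h2, h3, h4, h5⟩ := h
  rcases h1.lt_or_eq with h | h
  · linarith
  · rcases h2.lt_or_eq with h' | h'
    · linarith
    · simp [cross, ← h, ← h'] at h5

theorem IsPositivePair.weight_snd {C : (ℝ × ℝ) × (ℝ × ℝ)} (h : IsPositivePair C) :
    0 < C.2.1 + C.2.2 := by
  obtain ⟨h1, h2, h3, h4, h5⟩ := h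
  rcases h3.lt_or_eq with h | h
  · linarith
  · rcases h4.lt_or_eq with h' | h'
    · linarith
    · simp [cross, ← h, ← h'] at h5

theorem isPositivePair_cone {τ : List Bool → ℝ} (hτ : ∀ l, 0 < τ l) (l : List Bool) :
    IsPositivePair (cone τ l) := by
  induction l with
  | nil => constructor <;> simp [cone, cross]
  | cons b l ih =>
    obtain ⟨h1, h2, h3, h4, h5⟩ := ih
    have ht := hτ l
    have h6 : 0 < τ l * cross (cone τ l).1 (cone τ l).2 := mul_pos ht h5
    cases b
    · constructor <;> simp only [cone, Prod.fst_add, Prod.snd_add, Prod.smul_fst, Prod.smul_snd,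
        smul_eq_mul, cross] at * <;> first | positivity | linarith
    · constructor <;> simp only [cone, Prod.fst_add, Prod.snd_add, Prod.smul_fst, Prod.smul_snd,
        smul_eq_mul, cross] at * <;> first | positivity | linarith

theorem IsPositivePair.pos_lt_pos {C : (ℝ × ℝ) × (ℝ × ℝ)} (h : IsPositivePair C) :
    pos C.1 < pos C.2 := by
  rw [← sub_pos, pos_sub_pos h.weight_fst h.weight_snd]
  exact div_pos h.cross_pos (mul_pos h.weight_fst h.weight_snd)

/-- The subdivision of the unit interval by the positions of a tree of cones. -/
noncomputable def coneSubdivision (τ : List Bool → ℝ) (hτ : ∀ l, 0 < τ l) : Subdivision where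
  lo l := pos (cone τ l).1
  mid l := pos ((cone τ l).1 + τ l • (cone τ l).2)
  hi l := pos (cone τ l).2
  lo_nil := by simp [cone, pos]
  hi_nil := by simp [cone, pos]
  lo_true _ := rfl
  hi_true l := pos_smul (hτ l).ne' _
  lo_false _ := rfl
  hi_false _ := rfl
  lo_lt_mid l := (isPositivePair_cone hτ (false :: l)).pos_lt_pos
  mid_lt_hi l := by
    rw [← pos_smul (hτ l).ne' (cone τ l).2]
    exact (isPositivePair_cone hτ (true :: l)).pos_lt_pos

/-- The subdivision of the unit interval by the vertices of the Farey tesselation. -/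
noncomputable def fareySubdivision : Subdivision :=
  coneSubdivision (fun _ => 1) fun _ => one_pos

/-- The cones of the Farey tesselation have integral generators. -/
theorem exists_int_cone (l : List Bool) : ∃ a b c d : ℤ, a * d - b * c = 1 ∧
    cone (fun _ => 1) l = (((a : ℝ), (b : ℝ)), ((c : ℝ), (d : ℝ))) := by
  induction l with
  | nil => exact ⟨1, 0, 0, 1, by norm_num, by simp [cone]⟩
  | cons t l ih =>
    obtain ⟨a, b, c, d, h, e⟩ := ih
    cases t
    · exact ⟨a, b, a + c, b + d, by linear_combination h, by simp [cone, e]⟩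
    · exact ⟨a + c, b + d, c, d, by linear_combination h, by simp [cone, e]⟩

/-- An interval has length `1 / (w₁ * w₂)`, where `w₁, w₂ ≥ 1` are the coordinate sums of the
generators of a cone of determinant one. Each cut increases the product `w₁ * w₂` by at least one.
-/
theorem isDense_fareySubdivision : fareySubdivision.IsDense := by
  have key : ∀ l : List Bool, 1 ≤ (cone (fun _ => 1) l).1.1 + (cone (fun _ => 1) l).1.2 ∧
      1 ≤ (cone (fun _ => 1) l).2.1 + (cone (fun _ => 1) l).2.2 ∧
      cross (cone (fun _ => 1) l).1 (cone (fun _ => 1) l).2 = 1 ∧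
      (l.length : ℝ) + 1 ≤ ((cone (fun _ => 1) l).1.1 + (cone (fun _ => 1) l).1.2) *
        ((cone (fun _ => 1) l).2.1 + (cone (fun _ => 1) l).2.2) := by
    intro l
    induction l with
    | nil => simp [cone, cross]
    | cons t l ih =>
      obtain ⟨h1, h2, h3, h4⟩ := ih
      rw [cross] at h3
      cases t
      · simp only [cone, one_smul, Prod.fst_add, Prod.snd_add, cross, List.length_cons,
          Nat.cast_add, Nat.cast_one]
        exact ⟨h1, by linarith, by linarith, by nlinarith⟩
      · simp only [cone, one_smul, Prod.fst_add, Prod.snd_add, cross, List.length_cons,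
          Nat.cast_add, Nat.cast_one]
        exact ⟨by linarith, h2, by linarith, by nlinarith⟩
  refine Subdivision.isDense_of_length_le fun l => ?_
  obtain ⟨h1, h2, h3, h4⟩ := key l
  change (pos _ - pos _) * _ ≤ _
  rw [pos_sub_pos (by linarith) (by linarith), h3, one_div, inv_mul_le_iff₀ (by positivity)]
  linarith

/-! ### The tesselation and the developing map in coordinates -/

theorem edge_eq (i : Fin 3) (l : List Bool) :
    edge i l = ⟨ray (vec i (cone (fun _ => 1) l).1), ray (vec i (cone (fun _ => 1) l).2),
      ray (vec i (cone (fun _ => 1) l).2 - vec i (cone (fun _ => 1) l).1)⟩ := by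
  induction l with
  | nil => rw [edge, baseSide_eq]; simp [cone, vec]
  | cons t l ih =>
    have hw : wedge (vec i (cone (fun _ => 1) l).1) (vec i (cone (fun _ => 1) l).2) ≠ 0 := by
      rw [wedge_vec]
      exact (isPositivePair_cone (fun _ => one_pos) l).cross_pos.ne'
    rw [edge, OrientedEdge.child, ih]
    simp only [reflection_ray hw]
    cases t
    · simp [cone, vec_add]
    · simp [cone, vec_add, ray_neg]

/-- The exponentials of the shears, indexed by the edges beyond a side of the base triangle. -/
noncomputable def expShear (σ : edges → ℝ) (i : Fin 3) (l : List Bool) : ℝ :=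
  Real.exp (σ ⟨_, edge_mem i l⟩)

/-- The subdivision of the unit interval by the images of vertices under the developing map. -/
noncomputable def imageSubdivision (σ : edges → ℝ) (i : Fin 3) : Subdivision :=
  coneSubdivision (expShear σ i) fun _ => Real.exp_pos _

/-- On each triangle the developing map is the linear map taking the Farey basis to the basis of the
cone with the same label. Crossing an edge first scales the second Farey vector by the exponential
shear; the induction hypothesis then applies to the new coefficients, which is why they are
arbitrary. -/
theorem developOn_ray (σ : edges → ℝ) (i : Fin 3) (l : List Bool) (α β : ℝ)
    (h : α ≠ 0 ∨ β ≠ 0) :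
    developOn σ i l (ray (vec i (α • (cone (fun _ => 1) l).1 + β • (cone (fun _ => 1) l).2))) =
      ray (vec i (α • (cone (expShear σ i) l).1 + β • (cone (expShear σ i) l).2)) := by
  induction l generalizing α β with
  | nil => rfl
  | cons t l ih =>
    have hw : wedge (vec i (cone (fun _ => 1) l).1) (vec i (cone (fun _ => 1) l).2) ≠ 0 := by
      rw [wedge_vec]
      exact (isPositivePair_cone (fun _ => one_pos) l).cross_pos.ne'
    have step : ∀ α β : ℝ, (α ≠ 0 ∨ β ≠ 0) →
        developOn σ i (t :: l)
          (ray (vec i (α • (cone (fun _ => 1) l).1 + β • (cone (fun _ => 1) l).2))) =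
        ray (vec i (α • (cone (expShear σ i) l).1 +
          β • expShear σ i l • (cone (expShear σ i) l).2)) := by
      intro α β h
      have e1 : (edge i l).src = ray (vec i (cone (fun _ => 1) l).1) := by rw [edge_eq]
      have e2 : (edge i l).tgt = ray (vec i (cone (fun _ => 1) l).2) := by rw [edge_eq]
      obtain ⟨T, hT⟩ : ∃ T, T = σ ⟨_, edge_mem i l⟩ := ⟨_, rfl⟩
      have hτ : expShear σ i l = Real.exp T := by rw [hT]; rfl
      rw [developOn, Function.comp_apply, ← hT, e1, e2, vec_add, vec_smul, vec_smul,
        translation_ray hw _ _ _ h, ← vec_smul, ← vec_smul, ← vec_add,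
        ih _ _ (h.imp_right (mul_ne_zero (Real.exp_pos _).ne'))]
      rw [smul_smul, mul_comm β, hτ]
    cases t
    · have h' : α + β ≠ 0 ∨ β ≠ 0 := by
        by_cases hb : β = 0
        · left; simpa [hb] using h
        · exact Or.inr hb
      have := step (α + β) β h'
      simp only [cone, one_smul, smul_add, ← add_assoc, ← add_smul] at this ⊢
      exact this
    · have h' : α ≠ 0 ∨ α + β ≠ 0 := by
        by_cases ha : α = 0
        · right; simpa [ha] using h
        · exact Or.inl ha
      have := step α (α + β) h'
      simp only [cone, one_smul, smul_add, add_assoc, ← add_smul] at this ⊢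
      exact this

theorem edge_src (i : Fin 3) (l : List Bool) :
    (edge i l).src = arcPoint i (fareySubdivision.lo l) := by
  rw [edge_eq]
  exact ray_vec i (isPositivePair_cone (fun _ => one_pos) l).weight_fst

theorem edge_tgt (i : Fin 3) (l : List Bool) :
    (edge i l).tgt = arcPoint i (fareySubdivision.hi l) := by
  rw [edge_eq]
  exact ray_vec i (isPositivePair_cone (fun _ => one_pos) l).weight_snd

theorem developOn_src (σ : edges → ℝ) (i : Fin 3) (l : List Bool) :
    developOn σ i l (edge i l).src = arcPoint i ((imageSubdivision σ i).lo l) := by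
  have h := developOn_ray σ i l 1 0 (Or.inl one_ne_zero)
  simp only [one_smul, zero_smul, add_zero] at h
  rw [edge_eq]
  exact h.trans (ray_vec i (isPositivePair_cone (fun _ => Real.exp_pos _) l).weight_fst)

theorem developOn_tgt (σ : edges → ℝ) (i : Fin 3) (l : List Bool) :
    developOn σ i l (edge i l).tgt = arcPoint i ((imageSubdivision σ i).hi l) := by
  have h := developOn_ray σ i l 0 1 (Or.inr one_ne_zero)
  simp only [one_smul, zero_smul, zero_add] at h
  rw [edge_eq]
  exact h.trans (ray_vec i (isPositivePair_cone (fun _ => Real.exp_pos _) l).weight_snd)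

/-! ### The arcs cover the circle -/

theorem vec_ne_zero (i : Fin 3) (s : ℝ) : vec i (1 - s, s) ≠ 0 := by
  intro h
  have h1 := congrArg Complex.re h
  have h2 := congrArg Complex.im h
  fin_cases i <;> simp [vec, baseStart, baseEnd] at h1 h2
  linarith

theorem continuous_arcPoint (i : Fin 3) : Continuous (arcPoint i) := by
  have h : Continuous fun s : ℝ => vec i (1 - s, s) := by
    unfold vec
    fun_prop
  refine Topology.IsEmbedding.subtypeVal.continuous_iff.2 ?_
  have : ((fun z : Circle => (z : ℂ)) ∘ arcPoint i) =
      fun s => vec i (1 - s, s) / conj (vec i (1 - s, s)) :=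
    funext fun s => coe_ray (vec_ne_zero i s)
  change Continuous ((fun z : Circle => (z : ℂ)) ∘ arcPoint i)
  rw [this]
  exact h.div (Complex.continuous_conj.comp h) fun s => conj_ne_zero (vec_ne_zero i s)

theorem arcPoint_zero (i : Fin 3) : arcPoint i 0 = ray (baseStart i) := by
  simp [arcPoint, vec]

theorem arcPoint_one (i : Fin 3) : arcPoint i 1 = ray (baseEnd i) := by
  simp [arcPoint, vec]

/-- The arcs of distinct sides meet only at ends: the determinant of the two directions can vanish
only at extreme parameters, by nonnegativity of the products `a1`, …, `a4`. -/
theorem eq_of_arcPoint_eq {i j : Fin 3} {s t : ℝ} (hs : s ∈ Set.Icc (0 : ℝ) 1)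
    (ht : t ∈ Set.Icc (0 : ℝ) 1) (h : arcPoint i s = arcPoint j t) :
    (i = j ∧ s = t) ∨ ((s = 0 ∨ s = 1) ∧ (t = 0 ∨ t = 1)) := by
  obtain ⟨hs0, hs1⟩ := hs
  obtain ⟨ht0, ht1⟩ := ht
  rw [arcPoint, arcPoint, ray_eq_iff (vec_ne_zero _ _) (vec_ne_zero _ _)] at h
  have a1 : 0 ≤ s * t := mul_nonneg hs0 ht0
  have a2 : 0 ≤ s * (1 - t) := mul_nonneg hs0 (sub_nonneg.2 ht1)
  have a3 : 0 ≤ (1 - s) * t := mul_nonneg (sub_nonneg.2 hs1) ht0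
  have a4 : 0 ≤ (1 - s) * (1 - t) := mul_nonneg (sub_nonneg.2 hs1) (sub_nonneg.2 ht1)
  by_cases hij : i = j
  · subst hij
    rw [wedge_vec, cross] at h
    left
    exact ⟨rfl, by dsimp only at h; linarith⟩
  · right
    fin_cases i <;> fin_cases j <;> first | exact absurd rfl hij | skip
    all_goals
      simp [wedge, vec, baseStart, baseEnd] at h
      first
        | exact ⟨Or.inl (by nlinarith), Or.inl (by nlinarith)⟩
        | exact ⟨Or.inl (by nlinarith), Or.inr (by nlinarith)⟩
        | exact ⟨Or.inr (by nlinarith), Or.inl (by nlinarith)⟩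

theorem exists_arcPoint_eq (z : Circle) : ∃ i, ∃ s ∈ Set.Icc (0 : ℝ) 1, arcPoint i s = z := by
  have key : ∀ i s, ∀ w : ℂ, w ≠ 0 → ray w = z → wedge (vec i (1 - s, s)) w = 0 →
      arcPoint i s = z := fun i s w hw hz h => by
    rw [← hz, arcPoint, ray_eq_iff (vec_ne_zero _ _) hw, h]
  have hz := Circle.normSq_coe z
  by_cases h1 : (1 + z : ℂ) = 0
  · refine ⟨1, 1, by simp, ?_⟩
    rw [arcPoint_one]
    change ray ⟨0, 1⟩ = z
    rw [ray_I]
    apply Circle.ext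
    rw [eq_neg_of_add_eq_zero_right h1]
    simp
  -- `1 + z` bisects the angle between `1` and `z`. It lies in the open right half-plane, which the
  -- diagonal and the real axis cut into pieces belonging to the three sides.
  have hr : ray (1 + z) = z := by
    apply Circle.ext
    rw [coe_ray h1, div_eq_iff (conj_ne_zero h1), map_add, mul_add, Complex.mul_conj, hz]
    simp [add_comm]
  have hre : 0 < 1 + (z : ℂ).re := by
    rw [Complex.normSq_apply] at hz
    have h2 : -1 ≤ (z : ℂ).re := by nlinarith [mul_self_nonneg (z : ℂ).im]
    rcases h2.lt_or_eq with h | h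
    · linarith
    · refine absurd ?_ h1
      apply Complex.ext
      · simp [← h]
      · simpa [← h] using hz
  set a := 1 + (z : ℂ).re with ha
  set b := (z : ℂ).im with hb
  have hwr : (1 + z : ℂ).re = a := by simp [ha]
  have hwi : (1 + z : ℂ).im = b := by simp [hb]
  rcases le_total 0 b with hb0 | hb0
  · rcases le_total b a with hba | hba
    · refine ⟨0, b / a, ⟨by positivity, (div_le_one hre).2 hba⟩, key _ _ _ h1 hr ?_⟩
      simp only [wedge, hwr, hwi]
      simp [vec, baseStart, baseEnd]
      field_simp
      ring
    · have hbp : 0 < b := hre.trans_le hba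
      refine ⟨1, 1 - a / b, ⟨sub_nonneg.2 ((div_le_one hbp).2 hba), ?_⟩, key _ _ _ h1 hr ?_⟩
      · have : 0 ≤ a / b := by positivity
        linarith
      · simp only [wedge, hwr, hwi]
        simp [vec, baseStart, baseEnd]
        field_simp
        ring
  · have hab : 0 < a - b := by linarith
    obtain ⟨r, hr'⟩ : ∃ r, r = a / (a - b) := ⟨_, rfl⟩
    have hra : r * (a - b) = a := by rw [hr', div_mul_cancel₀ _ hab.ne']
    have hr0 : 0 ≤ r := hr' ▸ by positivity
    have hr1 : r ≤ 1 := hr' ▸ (div_le_one hab).2 (by linarith)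
    refine ⟨2, r, ⟨hr0, hr1⟩, key _ _ _ h1 hr ?_⟩
    simp only [wedge, hwr, hwi]
    simp [vec, baseStart, baseEnd]
    linear_combination hra

/-! ### The developing map is well defined -/

theorem apex_mem (i : Fin 3) : ∃ j, (baseSide i).apex = arcPoint j 0 := by
  fin_cases i
  · exact ⟨2, by rw [arcPoint_zero]; exact ray_I.symm⟩
  · exact ⟨0, by rw [arcPoint_zero]; exact ray_one.symm⟩
  · exact ⟨1, by rw [arcPoint_zero]; exact ray_diag.symm⟩

theorem developOn_apex (σ : edges → ℝ) (i : Fin 3) (l : List Bool) :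
    developOn σ i l (edge i l).apex =
      ray (vec i ((cone (expShear σ i) l).2 - (cone (expShear σ i) l).1)) := by
  have h := developOn_ray σ i l (-1) 1 (Or.inr one_ne_zero)
  simp only [neg_smul, one_smul, neg_add_eq_sub] at h
  rw [← h, edge_eq]
  simp only [vec, Prod.fst_sub, Prod.snd_sub]
  congr 2
  push_cast
  ring

/-- A triangle vertex and its image carry the same label `d`, which does not depend on `σ`. The apex
of a child is the end of the parent edge that the child lacks, since `(u + τ • v) - u = τ • v` and
`τ • v - (u + τ • v) = -u`. -/
theorem exists_pt_of_mem_leftTriangle {i : Fin 3} {l : List Bool} {z : Circle}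
    (hz : z ∈ (edge i l).leftTriangle) :
    ∃ j d, z = arcPoint j (fareySubdivision.pt d) ∧
      ∀ σ, developOn σ i l z = arcPoint j ((imageSubdivision σ j).pt d) := by
  rcases hz with rfl | rfl | rfl
  · obtain ⟨d, hd⟩ := Subdivision.exists_lo_eq_pt l
    exact ⟨i, d, by rw [edge_src, hd], fun σ => by rw [developOn_src, hd]⟩
  · obtain ⟨d, hd⟩ := Subdivision.exists_hi_eq_pt l
    exact ⟨i, d, by rw [edge_tgt, hd], fun σ => by rw [developOn_tgt, hd]⟩
  · cases l with
    | nil =>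
      obtain ⟨j, hj⟩ := apex_mem i
      exact ⟨j, .inl false, hj, fun σ => hj⟩
    | cons t k =>
      cases t
      · obtain ⟨d, hd⟩ := Subdivision.exists_hi_eq_pt k
        refine ⟨i, d, ?_, fun σ => ?_⟩
        · rw [← hd, ← edge_tgt]; rfl
        · rw [developOn_apex, ← hd]
          have hp := isPositivePair_cone (τ := expShear σ i) (fun _ => Real.exp_pos _) k
          simp only [cone, add_sub_cancel_left]
          rw [vec_smul, ray_real_mul (show expShear σ i k ≠ 0 from (Real.exp_pos _).ne'),
            ray_vec i hp.weight_snd]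
          rfl
      · obtain ⟨d, hd⟩ := Subdivision.exists_lo_eq_pt k
        refine ⟨i, d, ?_, fun σ => ?_⟩
        · rw [← hd, ← edge_src]; rfl
        · rw [developOn_apex, ← hd]
          have hp := isPositivePair_cone (τ := expShear σ i) (fun _ => Real.exp_pos _) k
          simp only [cone, sub_add_cancel_right]
          rw [← neg_one_smul ℝ, vec_smul, ray_real_mul (by norm_num), ray_vec i hp.weight_fst]
          rfl

theorem Subdivision.pt_eq_of_end {S T : Subdivision} {d : Bool ⊕ List Bool}
    (h : S.pt d = 0 ∨ S.pt d = 1) : T.pt d = S.pt d := by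
  rcases h with h | h
  · rw [h]; exact S.pt_eq T (e := .inl false) h
  · rw [h]; exact S.pt_eq T (e := .inl true) h

theorem arcPoint_congr {S : Subdivision} (T : Fin 3 → Subdivision) {i j : Fin 3}
    {d e : Bool ⊕ List Bool} (h : arcPoint i (S.pt d) = arcPoint j (S.pt e)) :
    arcPoint i ((T i).pt d) = arcPoint j ((T j).pt e) := by
  rcases eq_of_arcPoint_eq (S.pt_mem d) (S.pt_mem e) h with ⟨rfl, h'⟩ | ⟨h1, h2⟩
  · rw [S.pt_eq (T i) h']
  · rw [Subdivision.pt_eq_of_end h1, Subdivision.pt_eq_of_end h2, h]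

/-- The choice of triangle is immaterial: two labels of the same Farey point also label the same
image point. -/
theorem developingMap_eq_developOn {σ : edges → ℝ} {i : Fin 3} {l : List Bool} {z : Circle}
    (hz : z ∈ (edge i l).leftTriangle) : developingMap σ z = developOn σ i l z := by
  have hex : ∃ y, DevelopsTo σ z y := ⟨_, i, l, hz, rfl⟩
  rw [developingMap, dif_pos hex]
  obtain ⟨i', l', hz', h'⟩ := hex.choose_spec
  rw [← h']
  obtain ⟨j, d, e1, e2⟩ := exists_pt_of_mem_leftTriangle hz
  obtain ⟨j', d', e1', e2'⟩ := exists_pt_of_mem_leftTriangle hz'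
  rw [e2, e2']
  exact arcPoint_congr (imageSubdivision σ) (e1'.symm.trans e1)

theorem developingMap_src (σ : edges → ℝ) (i : Fin 3) (l : List Bool) :
    developingMap σ (edge i l).src = arcPoint i ((imageSubdivision σ i).lo l) := by
  rw [developingMap_eq_developOn (i := i) (l := l) (Or.inl rfl), developOn_src]

theorem developingMap_tgt (σ : edges → ℝ) (i : Fin 3) (l : List Bool) :
    developingMap σ (edge i l).tgt = arcPoint i ((imageSubdivision σ i).hi l) := by
  rw [developingMap_eq_developOn (i := i) (l := l) (Or.inr (Or.inl rfl)), developOn_tgt]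

/-! ### Integral vectors and fans -/

/-- The point of the circle represented by an integral vector. -/
noncomputable def intRay (P : ℤ × ℤ) : Circle := ray ⟨P.1, P.2⟩

/-- The determinant of two integral vectors. -/
def intDet (P Q : ℤ × ℤ) : ℤ := P.1 * Q.2 - P.2 * Q.1

theorem wedge_int (P Q : ℤ × ℤ) : wedge ⟨P.1, P.2⟩ ⟨Q.1, Q.2⟩ = intDet P Q := by
  simp [wedge, intDet]

theorem intRay_neg (P : ℤ × ℤ) : intRay (-P) = intRay P := by
  rw [intRay, intRay, ← ray_neg]
  congr 1
  simp [Complex.ext_iff]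

theorem exists_int_vec (i : Fin 3) (l : List Bool) : ∃ A B : ℤ × ℤ, intDet A B = 1 ∧
    vec i (cone (fun _ => 1) l).1 = ⟨A.1, A.2⟩ ∧ vec i (cone (fun _ => 1) l).2 = ⟨B.1, B.2⟩ := by
  obtain ⟨a, b, c, d, h, e⟩ := exists_int_cone l
  rw [e]
  fin_cases i
  · exact ⟨(a + b, b), (c + d, d), by simp only [intDet]; linear_combination h,
      by simp [vec, baseStart, baseEnd, Complex.ext_iff],
      by simp [vec, baseStart, baseEnd, Complex.ext_iff]⟩
  · exact ⟨(a, a + b), (c, c + d), by simp only [intDet]; linear_combination h,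
      by simp [vec, baseStart, baseEnd, Complex.ext_iff],
      by simp [vec, baseStart, baseEnd, Complex.ext_iff]⟩
  · exact ⟨(-b, a), (-d, c), by simp only [intDet]; linear_combination h,
      by simp [vec, baseStart, baseEnd, Complex.ext_iff],
      by simp [vec, baseStart, baseEnd, Complex.ext_iff]⟩

theorem eq_smul_of_intDet {P R D : ℤ × ℤ} (h : intDet P R = 1) (hD : intDet P D = 0) :
    D = intDet D R • P := by
  simp only [intDet] at *
  ext
  · simp only [Prod.smul_fst, smul_eq_mul]; linear_combination (-D.1) * h + R.1 * hD
  · simp only [Prod.smul_snd, smul_eq_mul]; linear_combination (-D.2) * h + R.2 * hD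

theorem ne_zero_of_intDet {P R : ℤ × ℤ} (h : intDet P R = 1) :
    (⟨P.1, P.2⟩ : ℂ) ≠ 0 ∧ (⟨R.1, R.2⟩ : ℂ) ≠ 0 :=
  ne_zero_of_wedge (by rw [wedge_int, h]; simp)

/-- Both vectors are primitive, so the integral factor between them is a unit. -/
theorem eq_or_eq_neg_of_intRay_eq {P R A B : ℤ × ℤ} (hP : intDet P R = 1) (hA : intDet A B = 1)
    (h : intRay P = intRay A) : A = P ∨ A = -P := by
  rw [intRay, intRay, ray_eq_iff (ne_zero_of_intDet hP).1 (ne_zero_of_intDet hA).1, wedge_int] at h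
  have e := eq_smul_of_intDet hP (D := A) (by exact_mod_cast h)
  set n := intDet A R
  have hn : n * intDet P B = 1 := by
    rw [← hA]
    conv_rhs => rw [e]
    simp [intDet]; ring
  rcases Int.isUnit_iff.1 (IsUnit.of_mul_eq_one _ hn) with h1 | h1
  · left; rw [e, h1, one_smul]
  · right; rw [e, h1, neg_one_smul]

/-- The neighbours of an integral point `P` are the points `R + n • P`. -/
theorem eq_intRay_add_of_mem_edges {P R : ℤ × ℤ} (hP : intDet P R = 1) {z : Circle}
    (hz : s(intRay P, z) ∈ edges) : ∃ n : ℤ, z = intRay (R + n • P) := by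
  obtain ⟨A, B, hAB, hA, hB⟩ : ∃ A B, intDet A B = 1 ∧ intRay P = intRay A ∧ z = intRay B := by
    obtain ⟨i, l, h⟩ := hz
    obtain ⟨A, B, hAB, hA, hB⟩ := exists_int_vec i l
    have h1 : (edge i l).src = intRay A := by rw [edge_eq, hA]; rfl
    have h2 : (edge i l).tgt = intRay B := by rw [edge_eq, hB]; rfl
    rw [h1, h2, Sym2.eq_iff] at h
    rcases h with ⟨h, h'⟩ | ⟨h, h'⟩
    · exact ⟨A, B, hAB, h, h'⟩
    · refine ⟨B, -A, ?_, h, by rw [intRay_neg, h']⟩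
      simp only [intDet, Prod.fst_neg, Prod.snd_neg] at *
      linear_combination hAB
  obtain ⟨B', hB', hz'⟩ : ∃ B', intDet P B' = 1 ∧ z = intRay B' := by
    rcases eq_or_eq_neg_of_intRay_eq hP hAB hA with rfl | rfl
    · exact ⟨B, hAB, hB⟩
    · refine ⟨-B, ?_, by rw [intRay_neg, hB]⟩
      simp only [intDet, Prod.fst_neg, Prod.snd_neg] at *
      linear_combination hAB
  have e := eq_smul_of_intDet hP (D := B' - R) (by
    simp only [intDet, Prod.fst_sub, Prod.snd_sub] at *
    linear_combination hB' - hP)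
  exact ⟨_, by rw [hz', ← e, add_sub_cancel]⟩

theorem horoParam_intRay_add {P R : ℤ × ℤ} (hP : intDet P R = 1) (n : ℤ) :
    horoParam (intRay P) (intRay (R + n • P)) =
      horoParam (intRay P) (intRay R) - n * ((P.1 : ℝ) ^ 2 + (P.2 : ℝ) ^ 2) := by
  have h2 : intDet P (R + n • P) = 1 := by
    simp only [intDet, Prod.fst_add, Prod.snd_add, Prod.smul_fst, Prod.smul_snd, smul_eq_mul] at *
    linear_combination hP
  have hw : wedge ⟨P.1, P.2⟩ ⟨R.1, R.2⟩ = 1 := by rw [wedge_int, hP]; simp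
  have hw2 : wedge ⟨P.1, P.2⟩ ⟨(R + n • P).1, (R + n • P).2⟩ = 1 := by rw [wedge_int, h2]; simp
  rw [intRay, intRay, intRay, horoParam_ray (by rw [hw2]; exact one_ne_zero),
    horoParam_ray (by rw [hw]; exact one_ne_zero), hw, hw2]
  simp
  ring

/-- All neighbours are of the form `R + n • P`, and the parameter drops by `n * |P|²`. Hence no
neighbour lies strictly between `R` and `R - P`, and a monotone indexing must pass from one to the
next. -/
theorem fanIndexing_succ {P R : ℤ × ℤ} (hP : intDet P R = 1) {q : ℤ → Circle}
    (hq : IsFanIndexing (intRay P) q) {k : ℤ} (hk : q k = intRay R)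
    (he : s(intRay P, intRay (R - P)) ∈ edges) : q (k + 1) = intRay (R - P) := by
  obtain ⟨hb, hmono⟩ := hq
  obtain ⟨k', -, hk'⟩ := hb.surjOn he
  obtain ⟨n, hn⟩ := eq_intRay_add_of_mem_edges hP (hb.mapsTo (Set.mem_univ (k + 1)))
  have h0 : (0 : ℝ) < (P.1 : ℝ) ^ 2 + (P.2 : ℝ) ^ 2 := by
    have := Complex.normSq_pos.2 (ne_zero_of_intDet hP).1
    rw [Complex.normSq_apply] at this
    simpa [sq] using this
  have e1 : R - P = R + (-1 : ℤ) • P := by simp [sub_eq_add_neg]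
  have p1 : horoParam (intRay P) (q k') =
      horoParam (intRay P) (q k) + ((P.1 : ℝ) ^ 2 + (P.2 : ℝ) ^ 2) := by
    rw [hk', hk, e1, horoParam_intRay_add hP]; push_cast; ring
  have p2 : horoParam (intRay P) (q (k + 1)) =
      horoParam (intRay P) (q k) - n * ((P.1 : ℝ) ^ 2 + (P.2 : ℝ) ^ 2) := by
    rw [hn, hk, horoParam_intRay_add hP]
  have l1 : k < k' := hmono.lt_iff_lt.1 (show horoParam _ _ < horoParam _ _ by rw [p1]; linarith)
  have l2 : horoParam (intRay P) (q (k + 1)) ≤ horoParam (intRay P) (q k') :=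
    hmono.monotone (show k + 1 ≤ k' by omega)
  have l3 : horoParam (intRay P) (q k) < horoParam (intRay P) (q (k + 1)) :=
    hmono (show k < k + 1 by omega)
  rw [p1, p2] at l2
  rw [p2] at l3
  have n1 : (-1 : ℝ) ≤ n := by
    by_contra! h
    nlinarith [mul_lt_mul_of_pos_right h h0]
  have n2 : (n : ℝ) < 0 := by
    by_contra! h
    nlinarith [mul_nonneg h h0.le]
  have n3 : (-1 : ℤ) ≤ n := by exact_mod_cast n1
  have n4 : n < 0 := by exact_mod_cast n2
  have : n = -1 := by omega
  rw [hn, this, e1]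

theorem exists_fanIndexing_eq {P R : ℤ × ℤ} (hP : intDet P R = 1) {q : ℤ → Circle}
    (hq : IsFanIndexing (intRay P) q) {N : ℕ}
    (he : ∀ j ≤ N, s(intRay P, intRay (R - (j : ℤ) • P)) ∈ edges) :
    ∃ k : ℤ, ∀ j ≤ N, q (k + j) = intRay (R - (j : ℤ) • P) := by
  obtain ⟨k, -, hk⟩ := hq.1.surjOn (he 0 (Nat.zero_le _))
  refine ⟨k, fun j => ?_⟩
  induction j with
  | zero => intro _; simpa using hk
  | succ j ih =>
    intro hj
    have e : R - ((j + 1 : ℕ) : ℤ) • P = (R - (j : ℤ) • P) - P := by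
      push_cast; rw [add_smul, one_smul]; abel
    have h1 := he (j + 1) hj
    rw [e] at h1 ⊢
    rw [Nat.cast_add, Nat.cast_one, ← add_assoc]
    refine fanIndexing_succ ?_ hq (ih (by omega)) h1
    simp only [intDet, Prod.fst_sub, Prod.snd_sub, Prod.smul_fst, Prod.smul_snd, smul_eq_mul] at *
    linear_combination hP

/-- The horocycle condition, for a block of consecutive edges of a fan whose images under the
developing map are in the right order. -/
theorem HorocycleCondition.exists_comparison {σ : edges → ℝ} (hσ : HorocycleCondition σ) :
    ∃ M : ℝ, 0 < M ∧ ∀ P R : ℤ × ℤ, intDet P R = 1 → ∀ N : ℕ, 1 ≤ N →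
      (∀ j ≤ 2 * N, s(intRay P, intRay (R - (j : ℤ) • P)) ∈ edges) →
      ∀ f : ℕ → ℝ, (∀ j ≤ 2 * N, f j =
        horoParam (developingMap σ (intRay P)) (developingMap σ (intRay (R - (j : ℤ) • P)))) →
      (∀ j < 2 * N, f j ≤ f (j + 1)) →
      f (2 * N) - f N ≤ M * (f N - f 0) ∧ f N - f 0 ≤ M * (f (2 * N) - f N) := by
  obtain ⟨M, hM, h⟩ := hσ
  have hM0 : 0 < M := by linarith
  refine ⟨M, hM0, fun P R hP N hN he f hf hmono => ?_⟩
  obtain ⟨q, hq, η, hη, hr⟩ := h (intRay P) ⟨_, he 0 (Nat.zero_le _)⟩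
  obtain ⟨k, hk⟩ := exists_fanIndexing_eq hP hq he
  have hlen : ∀ j < 2 * N, fanLength σ (intRay P) η q (k + j) = (f (j + 1) - f j) / η := by
    intro j hj
    rw [fanLength, horoArcLength_eq _ hη, hk j hj.le]
    have := hk (j + 1) hj
    rw [Nat.cast_add, Nat.cast_one, ← add_assoc] at this
    rw [this, hf j hj.le, hf (j + 1) hj, ← Nat.cast_one, ← Nat.cast_add, abs_of_nonneg]
    rw [← hf j hj.le, ← hf (j + 1) hj]
    exact sub_nonneg.2 (hmono j hj)
  have s1 : ∑ j ∈ Finset.range (N - 1 + 1), fanLength σ (intRay P) η q (k + N + j) =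
      (f (2 * N) - f N) / η := by
    rw [Nat.sub_add_cancel hN, show f (2 * N) - f N = f (N + N) - f (N + 0) by rw [two_mul, add_zero],
      ← Finset.sum_range_sub (fun j => f (N + j)), Finset.sum_div]
    refine Finset.sum_congr rfl fun j hj => ?_
    have := hlen (N + j) (by have := Finset.mem_range.1 hj; omega)
    rw [Nat.cast_add, ← add_assoc] at this
    rw [this, add_assoc]
  have s2 : ∑ j ∈ Finset.range (N - 1 + 1), fanLength σ (intRay P) η q (k + N - 1 - j) =
      (f N - f 0) / η := by
    rw [Nat.sub_add_cancel hN, ← Finset.sum_range_sub f, Finset.sum_div,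
      ← Finset.sum_range_reflect]
    refine Finset.sum_congr rfl fun j hj => ?_
    have hj' := Finset.mem_range.1 hj
    rw [← hlen j (by omega)]
    congr 1
    omega
  obtain ⟨r1, r2⟩ := hr (k + N) (N - 1)
  -- The blocks have `N` terms, so `k = N - 1` in the condition; the height `η` cancels.
  rw [s1, s2, div_div_div_cancel_right₀ hη.ne'] at r1 r2
  have d0 : 0 ≤ f N - f 0 := by
    rw [← Finset.sum_range_sub f]
    exact Finset.sum_nonneg fun j hj =>
      sub_nonneg.2 (hmono j (by have := Finset.mem_range.1 hj; omega))
  -- A vanishing denominator would make the quotient zero by convention, against the lower bound `1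
  -- / M`.
  have d1 : 0 < f N - f 0 := by
    refine lt_of_le_of_ne d0 fun h0 => ?_
    rw [← h0, div_zero] at r1
    exact absurd r1 (not_le.2 (by positivity))
  refine ⟨(div_le_iff₀ d1).1 r2, ?_⟩
  rw [div_le_div_iff₀ hM0 d1] at r1
  linarith

/-! ### Density of the image -/

theorem exists_horoParam_arcPoint (i : Fin 3) (p : ℝ) : ∃ a c : ℝ, 0 < c ∧ ∀ q : ℝ, q ≠ p →
    horoParam (arcPoint i p) (arcPoint i q) = a + c * (1 / (p - q)) := by
  set u := vec i (1 - p, p) with hu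
  -- With this `v`, the direction at `q` is `u + (q - p) • v` and `wedge u v = 1`, so the parameter
  -- is affine in `1 / (q - p)`.
  set v := vec i (-1, 1) with hv
  have h1 : wedge u v = 1 := by rw [hu, hv, wedge_vec]; simp [cross]
  refine ⟨-(u.re * v.re + u.im * v.im), u.re * u.re + u.im * u.im, ?_, fun q hq => ?_⟩
  · rw [← Complex.normSq_apply]
    exact Complex.normSq_pos.2 (ne_zero_of_wedge (by rw [h1]; exact one_ne_zero)).1
  · have hd : q - p ≠ 0 := sub_ne_zero.2 hq
    have hd' : p - q ≠ 0 := sub_ne_zero.2 hq.symm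
    have e : vec i (1 - q, q) = u + ((q - p : ℝ) : ℂ) * v := by
      rw [hu, hv, ← vec_smul, ← vec_add]
      congr 1
      ext <;> simp
    have h2 : wedge u (vec i (1 - q, q)) = q - p := by
      rw [hu, wedge_vec]; simp only [cross]; ring
    rw [arcPoint, arcPoint, ← hu, horoParam_ray (by rw [h2]; exact hd), h2, e]
    simp only [Complex.add_re, Complex.add_im, Complex.re_ofReal_mul, Complex.im_ofReal_mul]
    field_simp
    ring

theorem cone_replicate_true (j : ℕ) (l : List Bool) :
    cone (fun _ => 1) (List.replicate j true ++ l) =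
      ((cone (fun _ => 1) l).1 + (j : ℝ) • (cone (fun _ => 1) l).2, (cone (fun _ => 1) l).2) := by
  induction j with
  | zero => simp
  | succ j ih =>
    rw [List.replicate_succ, List.cons_append, cone, ih]
    simp only [one_smul, Nat.cast_add, Nat.cast_one, add_smul, add_assoc]

theorem cone_replicate_false (j : ℕ) (l : List Bool) :
    cone (fun _ => 1) (List.replicate j false ++ l) =
      ((cone (fun _ => 1) l).1, (j : ℝ) • (cone (fun _ => 1) l).1 + (cone (fun _ => 1) l).2) := by
  induction j with
  | zero => simp
  | succ j ih =>
    rw [List.replicate_succ, List.cons_append, cone, ih]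
    simp only [one_smul, Nat.cast_add, Nat.cast_one, add_smul]
    congr 1
    abel

theorem Subdivision.hi_replicate_true (S : Subdivision) (j : ℕ) (l : List Bool) :
    S.hi (List.replicate j true ++ l) = S.hi l := by
  induction j with
  | zero => rfl
  | succ j ih => rw [List.replicate_succ, List.cons_append, S.hi_true, ih]

theorem Subdivision.lo_replicate_false (S : Subdivision) (j : ℕ) (l : List Bool) :
    S.lo (List.replicate j false ++ l) = S.lo l := by
  induction j with
  | zero => rfl
  | succ j ih => rw [List.replicate_succ, List.cons_append, S.lo_false, ih]

theorem isDense_imageSubdivision {σ : edges → ℝ} (hσ : HorocycleCondition σ) (i : Fin 3) :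
    (imageSubdivision σ i).IsDense := by
  obtain ⟨M, hM, hc⟩ := hσ.exists_comparison
  set S := imageSubdivision σ i with hS
  refine Subdivision.isDense_of_comparison hM (fun l => ?_) (fun l N hN => ?_) fun l N hN => ?_
  · obtain ⟨A, B, hAB, hA, hB⟩ := exists_int_vec i l
    have hP : intRay (A + B) = (edge i (true :: l)).src := by
      rw [edge_eq, intRay]
      simp only [cone, one_smul, vec_add, hA, hB]
      congr 1
      simp [Complex.ext_iff]
    have hP' : (edge i (false :: l)).tgt = (edge i (true :: l)).src := by
      rw [edge_eq, edge_eq]; rfl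
    have hP2 : (edge i (false :: true :: l)).src = (edge i (true :: l)).src := by
      rw [edge_eq, edge_eq]; rfl
    have h0 : intRay (A + (2 : ℤ) • B) = (edge i (false :: true :: l)).tgt := by
      rw [edge_eq, intRay]
      simp only [cone, one_smul, vec_add, hA, hB]
      congr 1
      simp [Complex.ext_iff]
      constructor <;> ring
    have h1 : intRay B = (edge i (true :: l)).tgt := by
      rw [edge_eq, intRay]
      simp only [cone, one_smul, hB]
    have h2 : intRay A = (edge i (false :: l)).src := by
      rw [edge_eq, intRay]
      simp only [cone, hA]
    have r0 : A + (2 : ℤ) • B - ((0 : ℕ) : ℤ) • (A + B) = A + (2 : ℤ) • B := by simp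
    have r1 : A + (2 : ℤ) • B - ((1 : ℕ) : ℤ) • (A + B) = B := by
      rw [Nat.cast_one, one_smul, two_smul]; abel
    have r2 : A + (2 : ℤ) • B - ((2 : ℕ) : ℤ) • (A + B) = -A := by
      rw [Nat.cast_ofNat, two_smul, two_smul]; abel
    have a1 := S.lo_lt_mid l
    have a2 := S.mid_lt_hi l
    have a3 := S.lo_lt_mid (true :: l)
    have a4 := S.mid_lt_hi (true :: l)
    rw [S.lo_true] at a3
    rw [S.hi_true] at a4
    obtain ⟨a, c, hc0, hac⟩ := exists_horoParam_arcPoint i (S.mid l)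
    have dP : developingMap σ (edge i (true :: l)).src = arcPoint i (S.mid l) := by
      rw [developingMap_src, ← hS, S.lo_true]
    have d0 : developingMap σ (edge i (false :: true :: l)).tgt =
        arcPoint i (S.mid (true :: l)) := by
      rw [developingMap_tgt, ← hS, S.hi_false]
    have d1 : developingMap σ (edge i (true :: l)).tgt = arcPoint i (S.hi l) := by
      rw [developingMap_tgt, ← hS, S.hi_true]
    have d2 : developingMap σ (edge i (false :: l)).src = arcPoint i (S.lo l) := by
      rw [developingMap_src, ← hS, S.lo_false]
    -- The turn uses three consecutive edges of the fan at `mid l`, with Farey tip `A + B`. Their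
    -- order on the horocycle passes through infinity: `mid (true :: l)`, then `hi l`, then `lo l`.
    let x : ℕ → ℝ := fun j => if j = 0 then S.mid (true :: l) else if j = 1 then S.hi l else S.lo l
    have key := (hc (A + B) (A + (2 : ℤ) • B) (by
        simp only [intDet, Prod.fst_add, Prod.snd_add, Prod.smul_fst, Prod.smul_snd,
          smul_eq_mul] at *
        linear_combination hAB) 1 le_rfl (by
        intro j hj
        interval_cases j
        · rw [r0, hP, h0, ← hP2]; exact edge_mem _ _
        · rw [r1, hP, h1]; exact edge_mem _ _
        · rw [r2, intRay_neg, hP, h2, ← hP', Sym2.eq_swap]; exact edge_mem _ _)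
      (fun j => a + c * (1 / (S.mid l - x j))) (by
        intro j hj
        interval_cases j
        · rw [r0, hP, h0, dP, d0, hac _ a3.ne']; rfl
        · rw [r1, hP, h1, dP, d1, hac _ a2.ne']; rfl
        · rw [r2, intRay_neg, hP, h2, dP, d2, hac _ a1.ne]; rfl) (by
        intro j hj
        simp only [add_le_add_iff_left]
        refine mul_le_mul_of_nonneg_left ?_ hc0.le
        interval_cases j
        · exact one_div_le_one_div_of_neg_of_le (show S.mid l - S.mid (true :: l) < 0 by linarith)
            (show S.mid l - S.hi l ≤ S.mid l - S.mid (true :: l) by linarith)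
        · exact (one_div_neg.2 (show S.mid l - S.hi l < 0 by linarith)).le.trans
            (one_div_pos.2 (show 0 < S.mid l - S.lo l by linarith)).le)).1
    replace key : a + c * (1 / (S.mid l - S.lo l)) - (a + c * (1 / (S.mid l - S.hi l))) ≤
        M * (a + c * (1 / (S.mid l - S.hi l)) -
          (a + c * (1 / (S.mid l - S.mid (true :: l))))) := key
    have n1 : 1 / (S.mid l - S.hi l) = -(1 / (S.hi l - S.mid l)) := by
      rw [← neg_sub, one_div_neg_eq_neg_one_div]
    have n2 : 1 / (S.mid l - S.mid (true :: l)) = -(1 / (S.mid (true :: l) - S.mid l)) := by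
      rw [← neg_sub, one_div_neg_eq_neg_one_div]
    rw [n1, n2] at key
    refine le_of_mul_le_mul_left ?_ hc0
    linarith
  · obtain ⟨A, B, hAB, hA, hB⟩ := exists_int_vec i l
    have hP : ∀ j : ℕ, intRay B = (edge i (List.replicate j true ++ l)).tgt := fun j => by
      rw [edge_eq, cone_replicate_true, intRay, hB]
    -- For right runs the tip is `B`. The sign of `-A` gives determinant one and makes `R - j • P`
    -- the `j`-th left end up to sign.
    have hr : ∀ j : ℕ, intRay (-A - (j : ℤ) • B) = (edge i (List.replicate j true ++ l)).src :=
      fun j => by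
        rw [edge_eq, cone_replicate_true, ← intRay_neg, intRay]
        simp only [vec_add, vec_smul, hA, hB]
        congr 1
        simp [Complex.ext_iff]
        constructor <;> ring
    obtain ⟨a, c, hc0, hac⟩ := exists_horoParam_arcPoint i (S.hi l)
    have hlt : ∀ j : ℕ, S.lo (List.replicate j true ++ l) < S.hi l := fun j => by
      rw [← S.hi_replicate_true j l]; exact S.lo_lt_hi _
    have key := (hc B (-A) (by
        simp only [intDet, Prod.fst_neg, Prod.snd_neg] at *
        linear_combination hAB) N hN (by
        intro j _
        rw [hP j, hr j, Sym2.eq_swap]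
        exact edge_mem _ _)
      (fun j => a + c * (1 / (S.hi l - S.lo (List.replicate j true ++ l)))) (by
        intro j _
        rw [hr j, hP j, developingMap_src, developingMap_tgt, ← hS, S.hi_replicate_true,
          hac _ (hlt j).ne]) (by
        intro j _
        simp only [add_le_add_iff_left]
        refine mul_le_mul_of_nonneg_left (one_div_le_one_div_of_le (sub_pos.2 (hlt _)) ?_) hc0.le
        rw [List.replicate_succ, List.cons_append]
        exact sub_le_sub_left (S.lo_le_cons _ _) _)).2
    simp only [List.replicate_zero, List.nil_append] at key
    refine le_of_mul_le_mul_left ?_ hc0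
    linarith
  · obtain ⟨A, B, hAB, hA, hB⟩ := exists_int_vec i l
    have hP : ∀ j : ℕ, intRay A = (edge i (List.replicate j false ++ l)).src := fun j => by
      rw [edge_eq, cone_replicate_false, intRay, hA]
    have hr : ∀ j : ℕ, intRay (B + (j : ℤ) • A) = (edge i (List.replicate j false ++ l)).tgt :=
      fun j => by
        rw [edge_eq, cone_replicate_false, intRay]
        simp only [vec_add, vec_smul, hA, hB]
        congr 1
        simp [Complex.ext_iff, add_comm]
    obtain ⟨a, c, hc0, hac⟩ := exists_horoParam_arcPoint i (S.lo l)
    have hlt : ∀ j : ℕ, S.lo l < S.hi (List.replicate j false ++ l) := fun j => by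
      rw [← S.lo_replicate_false j l]; exact S.lo_lt_hi _
    -- For left runs the fan order is opposite to the depth, so the block is read from depth `2 * N`
    -- back to zero; the other of the two inequalities is then needed.
    have e : ∀ j ≤ 2 * N, B + ((2 * N : ℕ) : ℤ) • A - (j : ℤ) • A =
        B + ((2 * N - j : ℕ) : ℤ) • A := fun j hj => by
      rw [Nat.cast_sub hj, sub_smul]; abel
    have key := (hc A (B + ((2 * N : ℕ) : ℤ) • A) (by
        simp only [intDet, Prod.fst_add, Prod.snd_add, Prod.smul_fst, Prod.smul_snd,
          smul_eq_mul] at *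
        linear_combination hAB) N hN (by
        intro j hj
        rw [e j hj, hr, hP (2 * N - j)]
        exact edge_mem _ _)
      (fun j => a + c * (1 / (S.lo l - S.hi (List.replicate (2 * N - j) false ++ l)))) (by
        intro j hj
        rw [e j hj, hr, hP (2 * N - j), developingMap_src, developingMap_tgt, ← hS,
          S.lo_replicate_false, hac _ (hlt _).ne']) (by
        intro j hj
        simp only [add_le_add_iff_left]
        refine mul_le_mul_of_nonneg_left
          (one_div_le_one_div_of_neg_of_le (sub_neg.2 (hlt _)) ?_) hc0.le
        rw [show 2 * N - j = 2 * N - (j + 1) + 1 by omega, List.replicate_succ, List.cons_append]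
        exact sub_le_sub_left (S.hi_cons_le _ _) _)).1
    have n : ∀ k, 1 / (S.lo l - S.hi (List.replicate k false ++ l)) =
        -(1 / (S.hi (List.replicate k false ++ l) - S.lo l)) := fun k => by
      rw [← neg_sub, one_div_neg_eq_neg_one_div]
    have n0 := n 0
    simp only [List.replicate_zero, List.nil_append] at n0
    simp only [n, n0, Nat.sub_self, Nat.sub_zero, show 2 * N - N = N by omega, List.replicate_zero,
      List.nil_append] at key
    refine le_of_mul_le_mul_left ?_ hc0
    linarith

/-! ### The homeomorphism of the circle -/

/-- The three arcs beyond the sides of the base triangle, parametrized together. -/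
noncomputable def arcs (x : Fin 3 × Set.Icc (0 : ℝ) 1) : Circle := arcPoint x.1 x.2

theorem continuous_arcs : Continuous arcs := by
  rw [continuous_prod_of_discrete_left]
  exact fun i => (continuous_arcPoint i).comp continuous_subtype_val

theorem surjective_arcs : Function.Surjective arcs := fun z => by
  obtain ⟨i, s, hs, h⟩ := exists_arcPoint_eq z
  exact ⟨(i, ⟨s, hs⟩), h⟩

/-- Two parameters of the same point either coincide or are both ends of intervals, and order
isomorphisms fix the ends. -/
theorem arcs_congr (F : Fin 3 → Set.Icc (0 : ℝ) 1 ≃o Set.Icc (0 : ℝ) 1)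
    {x y : Fin 3 × Set.Icc (0 : ℝ) 1} (h : arcs x = arcs y) :
    arcs (x.1, F x.1 x.2) = arcs (y.1, F y.1 y.2) := by
  have hend : ∀ (i : Fin 3) (s : Set.Icc (0 : ℝ) 1), (s : ℝ) = 0 ∨ (s : ℝ) = 1 → F i s = s := by
    rintro i s (hs | hs)
    · rw [show s = ⊥ from Subtype.ext hs, (F i).map_bot]
    · rw [show s = ⊤ from Subtype.ext hs, (F i).map_top]
  obtain ⟨i, s⟩ := x
  obtain ⟨j, t⟩ := y
  rcases eq_of_arcPoint_eq s.2 t.2 h with ⟨h1, h2⟩ | ⟨h1, h2⟩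
  · dsimp only at h1 h2
    obtain rfl := Subtype.ext h2
    subst h1
    rfl
  · change arcs (i, F i s) = arcs (j, F j t)
    rw [hend i s h1, hend j t h2, h]

/-- Increasing homeomorphisms of the three arcs fit together to a homeomorphism of the circle. -/
theorem exists_homeomorph_arcs (F : Fin 3 → Set.Icc (0 : ℝ) 1 ≃o Set.Icc (0 : ℝ) 1) :
    ∃ H : Circle ≃ₜ Circle, ∀ x, H (arcs x) = arcs (x.1, F x.1 x.2) := by
  -- A continuous surjection from a compact space to a Hausdorff space is a quotient map, so
  -- continuity may be tested on the three intervals. The inverse arises from the inverse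
  -- isomorphisms.
  have hq : Topology.IsQuotientMap arcs :=
    continuous_arcs.isClosedMap.isQuotientMap continuous_arcs surjective_arcs
  have key : ∀ F : Fin 3 → Set.Icc (0 : ℝ) 1 ≃o Set.Icc (0 : ℝ) 1,
      ∃ h : Circle → Circle, Continuous h ∧ ∀ x, h (arcs x) = arcs (x.1, F x.1 x.2) := by
    intro F
    let h : Circle → Circle := fun z =>
      let x := Function.surjInv surjective_arcs z
      arcs (x.1, F x.1 x.2)
    have hh : ∀ x, h (arcs x) = arcs (x.1, F x.1 x.2) := fun x =>
      arcs_congr F (Function.surjInv_eq surjective_arcs (arcs x))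
    refine ⟨h, hq.continuous_iff.2 ?_, hh⟩
    have : h ∘ arcs = fun x => arcs (x.1, F x.1 x.2) := funext hh
    rw [this, continuous_prod_of_discrete_left]
    exact fun i => continuous_arcs.comp (Continuous.prodMk_right i |>.comp (F i).continuous)
  obtain ⟨h, hc, hh⟩ := key F
  obtain ⟨k, kc, kk⟩ := key fun i => (F i).symm
  refine ⟨⟨⟨h, k, ?_, ?_⟩, hc, kc⟩, hh⟩
  · intro z
    obtain ⟨x, rfl⟩ := surjective_arcs z
    rw [hh, kk]
    simp
  · intro z
    obtain ⟨x, rfl⟩ := surjective_arcs z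
    rw [kk, hh]
    simp

end Farey

/-! ### The extension to the circle -/

theorem lemma4p2 (σ : Farey.edges → ℝ) (hσ : Farey.HorocycleCondition σ) :
    ∃ H : Circle ≃ₜ Circle,
      (∀ x ∈ Farey.vertices, H x = Farey.developingMap σ x) ∧
      ∀ (i : Fin 3) (l : List Bool), ∀ x ∈ (Farey.edge i l).leftTriangle,
        H x = Farey.developOn σ i l x := by
  choose F hF using fun i => Farey.Subdivision.exists_orderIso Farey.isDense_fareySubdivision
    (Farey.isDense_imageSubdivision hσ i)
  obtain ⟨H, hH⟩ := Farey.exists_homeomorph_arcs F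
  have key : ∀ (i : Fin 3) (l : List Bool), ∀ x ∈ (Farey.edge i l).leftTriangle,
      H x = Farey.developOn σ i l x := by
    intro i l x hx
    obtain ⟨j, d, h1, h2⟩ := Farey.exists_pt_of_mem_leftTriangle hx
    rw [h2, h1]
    -- The isomorphism of arc `j` carries the Farey point labelled `d` to the image point labelled
    -- `d`.
    have h3 := hH (j, ⟨_, Farey.fareySubdivision.pt_mem d⟩)
    rw [hF] at h3
    exact h3
  refine ⟨H, ?_, key⟩
  rintro x ⟨y, i, l, h⟩
  have hx : x ∈ (Farey.edge i l).leftTriangle := by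
    rcases Sym2.eq_iff.1 h with ⟨h, -⟩ | ⟨h, -⟩
    · exact Or.inl h
    · exact Or.inr (Or.inl h)
  rw [key i l x hx, Farey.developingMap_eq_developOn hx]
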